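/- All Lie algebras and modules are finite-dimensional over $\mathbb C$. Let $\mathcal N$ be a nilpotent Lie algebra, $\mathcal T\subseteq\mathrm{Der}(\mathcal N)$ a maximal torus (a Lie algebra of simultaneously diagonalizable derivations, maximal under inclusion), and $\mathcal R_{\mathcal T}=\mathcal N\rtimes\mathcal T$. Let $W\subset\mathcal T^*$ be the set of weights of $\mathcal T$ on $\mathcal N=\bigoplus_{\alpha\in W}\mathcal N_\alpha$; a weight is primitive if it is a weight of $\mathcal T$ on $\mathcal N/\mathcal N^2$, where $\mathcal N^2=[\mathcal N,\mathcal N]$. Suppose that $\dim\mathcal T=\dim(\mathcal N/\mathcal N^2)=2$, that $\alpha_1\ne\alpha_2$ are primitive weights, that $\mathcal N$ is generated by $\mathcal N_{\alpha_1}$ and $\mathcal N_{\alpha_2}$, and that $3\alpha_1+\alpha_2\notin W$ and $\alpha_1+3\alpha_2\notin W$. Then: (a) Every $\mu\in W$ can be written uniquely as $\mu=p\alpha_1+q\alpha_2$ with integers $p,q\ge0$, and $\mathrm{diff}(\mu):=|p-q|\le 1$. (b) If $\tau_1,\tau_2,\tau_1+\tau_2\in W$ and $0\ne e_{\tau_i}\in\mathcal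 N_{\tau_i}$, then $[e_{\tau_1},e_{\tau_2}]=0$ if and only if $\mathrm{diff}(\tau_1)+\mathrm{diff}(\tau_2)=0$. (c) For every $\mathcal R_{\mathcal T}$-module $\mathcal M$ on which $\mathcal T$ acts diagonally with all weights in $W$, $H^2(\mathcal N,\mathcal M)^{\mathcal T}=0$. Here $H^2$ is Chevalley–Eilenberg cohomology, and $H^2(\mathcal N,\mathcal M)^{\mathcal T}$ is the space of classes annihilated by all $t\in\mathcal T$ under the action induced by $(t\cdot f)(x,y)=t\cdot f(x,y)-f([t,x],y)-f(x,[t,y])$. (d) $\mathcal R_{\mathcal T}$ is cohomologically rigid, that is, $H^2(\mathcal R_{\mathcal T},\mathcal R_{\mathcal T})=0$. -/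

import Mathlib

/-!
All Lie algebras are over `ℂ`. The cochains, the differentials `d₁₂`, `d₂₃` and the space
`twoCocycle` of 2-cocycles are Mathlib's (`LieModule.Cohomology`), the semidirect product
`N ⋊ T` is Mathlib's `LieAlgebra.SemiDirectSum`.
-/

noncomputable section

namespace MaxRank

open LieModule.Cohomology

/-- The quotient `Z / (Z ∩ B)` of subspaces of a vector space; it is `Z / B` when `B ≤ Z`. -/
abbrev Subquotient {V : Type*} [AddCommGroup V] [Module ℂ V] (Z B : Submodule ℂ V) : Type _ :=
  Z ⧸ B.submoduleOf Z

/-- The map induced on `Z / B` by an endomorphism that preserves `Z` and `B`. -/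
def Subquotient.map {V : Type*} [AddCommGroup V] [Module ℂ V] {Z B : Submodule ℂ V}
    (φ : V →ₗ[ℂ] V) (hZ : ∀ f ∈ Z, φ f ∈ Z) (hB : ∀ f ∈ B, φ f ∈ B) :
    Subquotient Z B →ₗ[ℂ] Subquotient Z B :=
  Submodule.mapQ _ _ (φ.restrict hZ) (fun f hf ↦ hB f hf)

section Cohomology

variable (L : Type*) [LieRing L] [LieAlgebra ℂ L]
variable (M : Type*) [AddCommGroup M] [Module ℂ M] [LieRingModule L M] [LieModule ℂ L M]

/-- The space of 2-cocycles `Z²(L, M) = ker d²`, as a space of bilinear maps. -/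
def Z2 : Submodule ℂ (L →ₗ[ℂ] L →ₗ[ℂ] M) :=
  (twoCocycle ℂ L M).map (twoCochain ℂ L M).subtype

/-- The space of 2-coboundaries `B²(L, M) = im d¹`, as a space of bilinear maps. -/
def B2 : Submodule ℂ (L →ₗ[ℂ] L →ₗ[ℂ] M) :=
  (LinearMap.range (d₁₂ ℂ L M)).map (twoCochain ℂ L M).subtype

/-- The second Chevalley–Eilenberg cohomology `H²(L, M) = Z²(L, M) / B²(L, M)`. -/
abbrev H2 : Type _ := Subquotient (Z2 L M) (B2 L M)

variable {L M} in
theorem mem_Z2_iff {f : L →ₗ[ℂ] L →ₗ[ℂ] M} :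
    f ∈ Z2 L M ↔ (∀ x, f x x = 0) ∧ ∀ x y z, ⁅x, f y z⁆ - ⁅y, f x z⁆ + ⁅z, f x y⁆
      - f ⁅x, y⁆ z + f ⁅x, z⁆ y - f ⁅y, z⁆ x = 0 := by
  constructor
  · rintro ⟨g, hg, rfl⟩
    refine ⟨g.2, fun x y z ↦ ?_⟩
    have h := (mem_twoCocycle_iff ℂ L M g).1 hg
    have := congrArg (fun b ↦ b x y z) h
    simpa using this
  · rintro ⟨h1, h2⟩
    refine ⟨⟨f, h1⟩, (mem_twoCocycle_iff ℂ L M _).2 ?_, rfl⟩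
    ext x y z
    exact h2 x y z

variable {L M} in
theorem mem_B2_iff {f : L →ₗ[ℂ] L →ₗ[ℂ] M} :
    f ∈ B2 L M ↔ ∃ g : L →ₗ[ℂ] M, ∀ x y, f x y = ⁅x, g y⁆ - ⁅y, g x⁆ - g ⁅x, y⁆ := by
  constructor
  · rintro ⟨_, ⟨g, rfl⟩, rfl⟩
    exact ⟨g, fun x y ↦ rfl⟩
  · rintro ⟨g, hg⟩
    refine ⟨d₁₂ ℂ L M g, ⟨g, rfl⟩, ?_⟩
    ext x y
    exact (hg x y).symm

theorem B2_le_Z2 : B2 L M ≤ Z2 L M := by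
  rintro _ ⟨_, ⟨g, rfl⟩, rfl⟩
  exact ⟨d₁₂ ℂ L M g, (mem_twoCocycle_iff ℂ L M _).2
    (LinearMap.congr_fun (d₂₃_comp_d₁₂ ℂ L M) g), rfl⟩

/-- A Lie algebra `G` is cohomologically rigid if `H²(G, G) = 0`. -/
def IsCohomologicallyRigid (G : Type*) [LieRing G] [LieAlgebra ℂ G] : Prop :=
  Subsingleton (H2 G G)

end Cohomology

section Weights

variable {T V : Type*} [AddCommGroup T] [Module ℂ T] [AddCommGroup V] [Module ℂ V]

/-- The weight space of weight `χ` for a linear action `ρ` of `T` on `V`: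
the common eigenspace `{v | ρ t v = χ t • v for all t}`. -/
def weightSpace (ρ : T →ₗ[ℂ] Module.End ℂ V) (χ : Module.Dual ℂ T) : Submodule ℂ V where
  carrier := {v | ∀ t, ρ t v = χ t • v}
  add_mem' hv hw t := by simp [hv t, hw t]
  zero_mem' t := by simp
  smul_mem' c v hv t := by simp [hv t, smul_comm c]

/-- The set of weights of the action `ρ`. -/
def weights (ρ : T →ₗ[ℂ] Module.End ℂ V) : Set (Module.Dual ℂ T) :=
  {χ | weightSpace ρ χ ≠ ⊥}

/-- The action `ρ` is (simultaneously) diagonal: `V` is spanned by common eigenvectors. -/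
def IsDiagonal (ρ : T →ₗ[ℂ] Module.End ℂ V) : Prop :=
  ⨆ χ, weightSpace ρ χ = ⊤

end Weights

section Torus

variable {N : Type*} [LieRing N] [LieAlgebra ℂ N]

/-- The tautological action on `N` of a Lie algebra `T` of derivations of `N`. -/
def derAction (T : LieSubalgebra ℂ (LieDerivation ℂ N N)) : T →ₗ[ℂ] Module.End ℂ N where
  toFun t := ((t : LieDerivation ℂ N N) : N →ₗ[ℂ] N)
  map_add' _ _ := rfl
  map_smul' _ _ := rfl

/-- A torus on `N`: a Lie algebra of simultaneously diagonalizable derivations of `N`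
(over `ℂ`, in finite dimension, the same as an abelian algebra of semisimple derivations). -/
def IsTorus (T : LieSubalgebra ℂ (LieDerivation ℂ N N)) : Prop :=
  IsDiagonal (derAction T)

/-- A maximal torus on `N`: a torus that is maximal with respect to inclusion. -/
def IsMaximalTorus (T : LieSubalgebra ℂ (LieDerivation ℂ N N)) : Prop :=
  Maximal IsTorus T

variable (T : LieSubalgebra ℂ (LieDerivation ℂ N N))

/-- The weight space `N_χ` of `N` with respect to the torus `T`. -/
abbrev rootSpace (χ : Module.Dual ℂ T) : Submodule ℂ N :=
  weightSpace (derAction T) χ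

/-- The set `W` of weights of `T` on `N`. -/
abbrev roots : Set (Module.Dual ℂ T) :=
  weights (derAction T)

variable (N) in
/-- The derived ideal `N² = [N, N]`. -/
abbrev derivedIdeal : LieIdeal ℂ N := ⁅(⊤ : LieIdeal ℂ N), (⊤ : LieIdeal ℂ N)⁆

/-- A weight is primitive if it is a weight of `T` on `N / N²`, that is, if `N_χ ⊄ N²`. -/
def IsPrimitive (χ : Module.Dual ℂ T) : Prop :=
  ¬ rootSpace T χ ≤ (derivedIdeal N).toSubmodule

/-- The solvable Lie algebra `R_T = N ⋊ T`. -/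
abbrev solvableExt : Type _ := N ⋊⁅T.incl⁆ T

end Torus

section InvariantCohomology

variable {N : Type*} [LieRing N] [LieAlgebra ℂ N]
variable (T : LieSubalgebra ℂ (LieDerivation ℂ N N))

/-- An `R_T`-module `M`, regarded as an `N`-module through the inclusion `N → N ⋊ T`. -/
def ResN (_ : LieSubalgebra ℂ (LieDerivation ℂ N N)) (M : Type*) : Type _ := M

variable (M : Type*) [AddCommGroup M] [Module ℂ M]

instance : AddCommGroup (ResN T M) := inferInstanceAs (AddCommGroup M)

instance : Module ℂ (ResN T M) := inferInstanceAs (Module ℂ M)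

variable [LieRingModule (solvableExt T) M] [LieModule ℂ (solvableExt T) M]

instance : LieRingModule (solvableExt T) (ResN T M) :=
  inferInstanceAs (LieRingModule (solvableExt T) M)

instance : LieModule ℂ (solvableExt T) (ResN T M) :=
  inferInstanceAs (LieModule ℂ (solvableExt T) M)

instance : LieRingModule N (ResN T M) :=
  LieRingModule.compLieHom (ResN T M) (LieAlgebra.SemiDirectSum.inl T.incl)

instance : LieModule ℂ N (ResN T M) :=
  LieModule.compLieHom (ResN T M) (LieAlgebra.SemiDirectSum.inl T.incl)

/-- The action of `T` on an `R_T`-module `M`. -/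
def torusAction : T →ₗ[ℂ] Module.End ℂ M :=
  (LieModule.toEnd ℂ (solvableExt T) M : solvableExt T →ₗ[ℂ] Module.End ℂ M) ∘ₗ
    (LieAlgebra.SemiDirectSum.inr T.incl : T →ₗ[ℂ] solvableExt T)

/-- The action of `t ∈ T` on bilinear maps `N × N → M`:
`(t • f)(x, y) = t • f(x, y) - f([t, x], y) - f(x, [t, y])`, where `[t, x] = t x`. -/
def cochainAction (t : T) :
    (N →ₗ[ℂ] N →ₗ[ℂ] ResN T M) →ₗ[ℂ] (N →ₗ[ℂ] N →ₗ[ℂ] ResN T M) where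
  toFun f := LinearMap.mk₂ ℂ
    (fun x y ↦ torusAction T (ResN T M) t (f x y)
      - f (derAction T t x) y - f x (derAction T t y))
    (fun _ _ _ ↦ by simp only [map_add, LinearMap.add_apply]; abel)
    (fun _ _ _ ↦ by simp only [map_smul, LinearMap.smul_apply, smul_sub])
    (fun _ _ _ ↦ by simp only [map_add]; abel)
    (fun _ _ _ ↦ by simp only [map_smul, smul_sub])
  map_add' f g := by
    ext x y
    simp only [LinearMap.mk₂_apply, map_add, LinearMap.add_apply]
    abel
  map_smul' c f := by
    ext x y
    simp [smul_sub]

theorem torusAction_lie (t : T) (x : N) (m : ResN T M) :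
    torusAction T (ResN T M) t ⁅x, m⁆
      = ⁅derAction T t x, m⁆ + ⁅x, torusAction T (ResN T M) t m⁆ := by
  have h := leibniz_lie (LieAlgebra.SemiDirectSum.inr T.incl t)
    (LieAlgebra.SemiDirectSum.inl T.incl x) m
  have e : ⁅LieAlgebra.SemiDirectSum.inr T.incl t, LieAlgebra.SemiDirectSum.inl T.incl x⁆
      = LieAlgebra.SemiDirectSum.inl T.incl (derAction T t x) := by
    simp [derAction]
  rw [e] at h
  exact h

theorem derAction_lie (t : T) (x y : N) :
    derAction T t ⁅x, y⁆ = ⁅derAction T t x, y⁆ + ⁅x, derAction T t y⁆ := by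
  have h := LieDerivation.apply_lie_eq_add (t : LieDerivation ℂ N N) x y
  rw [add_comm] at h
  exact h

theorem cochainAction_apply (t : T) (f : N →ₗ[ℂ] N →ₗ[ℂ] ResN T M) (x y : N) :
    cochainAction T M t f x y = torusAction T (ResN T M) t (f x y)
      - f (derAction T t x) y - f x (derAction T t y) := rfl

theorem cochainAction_mem_Z2 (t : T) (f : N →ₗ[ℂ] N →ₗ[ℂ] ResN T M)
    (hf : f ∈ Z2 N (ResN T M)) : cochainAction T M t f ∈ Z2 N (ResN T M) := by
  obtain ⟨h1, h2⟩ := mem_Z2_iff.1 hf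
  have skew : ∀ x y, f x y = - f y x := fun x y ↦ by
    have := h1 (x + y)
    simp only [map_add, LinearMap.add_apply, h1, zero_add, add_zero] at this
    rw [← sub_eq_zero, sub_neg_eq_add, add_comm]
    exact this
  refine mem_Z2_iff.2 ⟨fun x ↦ ?_, fun x y z ↦ ?_⟩
  · rw [cochainAction_apply, h1, map_zero, skew x]
    abel
  · have a := h2 (derAction T t x) y z
    have b := h2 x (derAction T t y) z
    have c := h2 x y (derAction T t z)
    have d := congrArg (torusAction T (ResN T M) t) (h2 x y z)
    simp only [map_add, map_sub, map_zero, torusAction_lie] at d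
    simp only [cochainAction_apply, lie_sub, derAction_lie, map_add, LinearMap.add_apply]
    have e : ∀ p a b c : ResN T M, p = 0 → a = 0 → b = 0 → c = 0 → p - a - b - c = 0 := by
      rintro _ _ _ _ rfl rfl rfl rfl; simp
    rw [← e _ _ _ _ d a b c]
    abel

theorem cochainAction_mem_B2 (t : T) (f : N →ₗ[ℂ] N →ₗ[ℂ] ResN T M)
    (hf : f ∈ B2 N (ResN T M)) : cochainAction T M t f ∈ B2 N (ResN T M) := by
  obtain ⟨g, hg⟩ := mem_B2_iff.1 hf
  refine mem_B2_iff.2 ⟨torusAction T (ResN T M) t ∘ₗ g - g ∘ₗ derAction T t, fun x y ↦ ?_⟩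
  simp only [cochainAction_apply, hg, map_sub, torusAction_lie, LinearMap.sub_apply,
    LinearMap.comp_apply, lie_sub, derAction_lie, map_add]
  abel

/-- The action of `t ∈ T` on `H²(N, M)` induced by its action on cochains. -/
def cohomologyAction (t : T) : H2 N (ResN T M) →ₗ[ℂ] H2 N (ResN T M) :=
  Subquotient.map (cochainAction T M t) (cochainAction_mem_Z2 T M t)
    (cochainAction_mem_B2 T M t)

/-- The space `H²(N, M)^T` of `T`-invariant classes in `H²(N, M)`. -/
def invariantH2 : Submodule ℂ (H2 N (ResN T M)) :=
  ⨅ t : T, LinearMap.ker (cohomologyAction T M t)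

end InvariantCohomology

/-- For `μ = p α₁ + q α₂`, the number `diff(μ) = |p - q|`. -/
def diff (p q : ℕ) : ℕ := ((p : ℤ) - (q : ℤ)).natAbs

end MaxRank

end

/-!
The torus has rank two, so the roots `α₁` and `α₂` of the generators `e₁` and `e₂` of `N` form a
basis of its dual and grade `N` by pairs of natural numbers. As `3 α₁ + α₂` and `α₁ + 3 α₂` are not
roots, `e₁` and `e₂` satisfy the Serre relations of the affine type `A₁⁽¹⁾`, and `N` is a graded
quotient of the positive part of `A₁⁽¹⁾`. This positive part is worked out by hand: a Lie algebra
generated by `x` and `y` with `(ad x)³ y = 0 = (ad y)³ x` is spanned by elements `aₖ`, `bₖ`, `cₖ` of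
degrees `(k + 1, k)`, `(k, k + 1)`, `(k + 1, k + 1)`, whose only nonzero brackets are
`[aᵢ, bⱼ] = cᵢ₊ⱼ`, `[cᵢ, aⱼ] = 2 aᵢ₊ⱼ₊₁` and `[cᵢ, bⱼ] = -2 bᵢ₊ⱼ₊₁` (`lie_serreVec`,
`span_serreVec`). The description of the roots and the criterion for a bracket of root vectors to
vanish are read off from this table.

For the cohomology of `N`, a class in `H²(N, M)` that is killed by `T` has an invariant
representative, as `T` acts semisimply on cochains (`exists_invariant_sub_mem`). It defines an
extension `E` of `N` by `M` on which `T` acts by derivations. All the defining relations of `N`, the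
Serre relations and those that truncate the positive part of `A₁⁽¹⁾`, have weights that are not
roots. These are not weights of `E` either, so the relations hold for the lifts of `e₁` and `e₂`,
and `E → N` has an equivariant section (`IsGenerating.exists_equivariant_cochain`). The argument
allows `M` to have the weight zero.

For the rigidity of `N ⋊ T`, Cartan's formula provides an invariant representative `f` of a class
(`lieDerivative_eq`). For `t ∈ T` the map `f(t, ·)` is an invariant derivation. On `N` such a
derivation scales `e₁` and `e₂`, so it is given by an element of `T`, and `f` may be changed by a
coboundary so as to vanish on `T × (N ⋊ T)` (`IsGenerating.mem_B2_of_invariant`). What is left is an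
invariant cocycle of `N` with values in `N ⋊ T`, whose weights are zero or roots, and it is the
coboundary of an equivariant cochain.
-/

noncomputable section

namespace MaxRank

/-! ### The Serre relations of type `A₁⁽¹⁾` -/

section Serre

variable {L : Type*} [LieRing L] [LieAlgebra ℂ L]

/-- The chain `b₀ = y`, `bₖ₊₁ = ½ [y, [x, bₖ]]`. -/
def serreB (x y : L) : ℕ → L
  | 0 => y
  | k + 1 => (1 / 2 : ℂ) • ⁅y, ⁅x, serreB x y k⁆⁆

/-- The chain `cₖ = [x, bₖ]`. -/
def serreC (x y : L) (k : ℕ) : L := ⁅x, serreB x y k⁆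

/-- The chain `a₀ = x`, `aₖ₊₁ = -½ [x, cₖ]`. -/
def serreA (x y : L) : ℕ → L
  | 0 => x
  | k + 1 => (-1 / 2 : ℂ) • ⁅x, serreC x y k⁆

variable {x y : L}

theorem serreA_succ (k : ℕ) : serreA x y (k + 1) = (-1 / 2 : ℂ) • ⁅x, serreC x y k⁆ := rfl

theorem serreB_succ (k : ℕ) : serreB x y (k + 1) = (1 / 2 : ℂ) • ⁅y, ⁅x, serreB x y k⁆⁆ := rfl

theorem lie_left_serreC (k : ℕ) : ⁅x, serreC x y k⁆ = (-2 : ℂ) • serreA x y (k + 1) := by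
  rw [serreA, smul_smul]; norm_num

theorem lie_right_serreC (k : ℕ) : ⁅y, serreC x y k⁆ = (2 : ℂ) • serreB x y (k + 1) := by
  rw [serreB, smul_smul, serreC]; norm_num

/-- The part of the multiplication table that is proved by simultaneous induction on `n`. -/
structure SerreTable (x y : L) (n : ℕ) : Prop where
  xa : ⁅x, serreA x y n⁆ = 0
  yb : ⁅y, serreB x y n⁆ = 0
  ab : ∀ i j, i + j = n → ⁅serreA x y i, serreB x y j⁆ = serreC x y n
  cc : ⁅serreC x y 0, serreC x y n⁆ = 0

namespace SerreTable

variable {n : ℕ}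

theorem ya (h : SerreTable x y n) : ⁅y, serreA x y n⁆ = -serreC x y n := by
  rw [← h.ab n 0 rfl, ← lie_skew, serreB]

theorem ca (h : SerreTable x y n) :
    ⁅serreC x y 0, serreA x y n⁆ = (2 : ℂ) • serreA x y (n + 1) := by
  rw [serreC, serreB, lie_lie, h.ya, h.xa, lie_zero, lie_neg, lie_left_serreC]
  module

theorem cb (h : SerreTable x y n) :
    ⁅serreC x y 0, serreB x y n⁆ = (-2 : ℂ) • serreB x y (n + 1) := by
  rw [serreC, serreB, lie_lie, h.yb, ← serreC, lie_zero, lie_right_serreC]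
  module

end SerreTable

theorem serreTable_zero : SerreTable x y 0 where
  xa := lie_self x
  yb := lie_self y
  ab i j h := by
    obtain ⟨rfl, rfl⟩ : i = 0 ∧ j = 0 := by omega
    rfl
  cc := lie_self _

/-- Bracketing `[aᵢ, bⱼ] = cₙ`, for `i + j = n`, with `c₀` gives `[aᵢ₊₁, bⱼ] = [aᵢ, bⱼ₊₁]`, because
`[c₀, cₙ] = 0`. So `[aᵢ, bⱼ]`, for `i + j = n + 1`, does not depend on `i`. -/
theorem lie_serreA_serreB_succ {n : ℕ} (H : ∀ k ≤ n, SerreTable x y k) (i j : ℕ)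
    (hij : i + j = n + 1) : ⁅serreA x y i, serreB x y j⁆ = serreC x y (n + 1) := by
  induction i generalizing j with
  | zero =>
    obtain rfl : j = n + 1 := by omega
    rfl
  | succ i ih =>
    have hc := (H n le_rfl).cc
    rw [← (H n le_rfl).ab i j (by omega), leibniz_lie, (H i (by omega)).ca,
      (H j (by omega)).cb, smul_lie, lie_smul, ih (j + 1) (by omega)] at hc
    have h2 : (2 : ℂ) • (⁅serreA x y (i + 1), serreB x y j⁆ - serreC x y (n + 1)) = 0 := by
      rw [← hc]; module
    exact sub_eq_zero.1 ((smul_eq_zero.1 h2).resolve_left two_ne_zero)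

theorem lie_left_serreA_succ (hx : ⁅x, ⁅x, ⁅x, y⁆⁆⁆ = 0) {n : ℕ}
    (H : ∀ k ≤ n, SerreTable x y k) : ⁅x, serreA x y (n + 1)⁆ = 0 := by
  have h1 : ⁅x, serreA x y 1⁆ = 0 := by
    rw [serreA, lie_smul, serreC, serreB, hx, smul_zero]
  obtain _ | m := n
  · exact h1
  -- Writing `a_{m+2}` as `-½ [x, [a_1, b_m]]` and as `½ [c_0, a_{m+1}]` gives two values for
  -- `[x, a_{m+2}]`, which are opposite to each other.
  have e1 : ⁅x, serreA x y (m + 2)⁆ = ⁅serreA x y 1, serreA x y (m + 1)⁆ := by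
    rw [serreA, lie_smul, ← (H (m + 1) le_rfl).ab 1 m (by omega), leibniz_lie x (serreA x y 1), h1,
      zero_lie, zero_add, leibniz_lie x (serreA x y 1), h1, zero_lie, zero_add, ← serreC,
      lie_left_serreC, lie_smul, smul_smul]
    norm_num
  have e2 : ⁅x, serreA x y (m + 2)⁆ = -⁅serreA x y 1, serreA x y (m + 1)⁆ := by
    have h := (H (m + 1) le_rfl).ca
    have h' : ⁅x, ⁅serreC x y 0, serreA x y (m + 1)⁆⁆ = (2 : ℂ) • ⁅x, serreA x y (m + 2)⁆ := by
      rw [h, lie_smul]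
    rw [leibniz_lie, (H (m + 1) le_rfl).xa, lie_zero, add_zero, lie_left_serreC, smul_lie] at h'
    have : (2 : ℂ) • (⁅x, serreA x y (m + 2)⁆ + ⁅serreA x y 1, serreA x y (m + 1)⁆) = 0 := by
      rw [smul_add, ← h']; module
    exact eq_neg_of_add_eq_zero_left ((smul_eq_zero.1 this).resolve_left two_ne_zero)
  rw [e1, eq_neg_iff_add_eq_zero, ← two_smul ℂ] at e2
  rw [e1]
  exact (smul_eq_zero.1 e2).resolve_left two_ne_zero

theorem lie_right_serreB_succ (hy : ⁅y, ⁅y, ⁅y, x⁆⁆⁆ = 0) {n : ℕ}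
    (H : ∀ k ≤ n, SerreTable x y k) : ⁅y, serreB x y (n + 1)⁆ = 0 := by
  have h1 : ⁅y, serreB x y 1⁆ = 0 := by
    rw [serreB, lie_smul, serreB, ← lie_skew x y, lie_neg, lie_neg, hy, neg_zero, smul_zero]
  obtain _ | m := n
  · exact h1
  -- Symmetrically, from `½ [y, [a_m, b_1]]` and `-½ [c_0, b_{m+1}]`.
  have e1 : ⁅y, serreB x y (m + 2)⁆ = ⁅serreB x y 1, serreB x y (m + 1)⁆ := by
    rw [serreB, lie_smul, ← serreC, ← (H (m + 1) le_rfl).ab m 1 (by omega),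
      leibniz_lie y (serreA x y m), h1, lie_zero, add_zero, (H m (by omega)).ya, neg_lie,
      lie_neg, leibniz_lie y (serreC x y m), h1, lie_zero, add_zero, lie_right_serreC,
      smul_lie, ← lie_skew]
    module
  have e2 : ⁅y, serreB x y (m + 2)⁆ = -⁅serreB x y 1, serreB x y (m + 1)⁆ := by
    have h := (H (m + 1) le_rfl).cb
    have h' : ⁅y, ⁅serreC x y 0, serreB x y (m + 1)⁆⁆ = (-2 : ℂ) • ⁅y, serreB x y (m + 2)⁆ := by
      rw [h, lie_smul]
    rw [leibniz_lie, (H (m + 1) le_rfl).yb, lie_zero, add_zero, lie_right_serreC, smul_lie] at h'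
    have : (-2 : ℂ) • (⁅y, serreB x y (m + 2)⁆ + ⁅serreB x y 1, serreB x y (m + 1)⁆) = 0 := by
      rw [smul_add, ← h']; module
    exact eq_neg_of_add_eq_zero_left ((smul_eq_zero.1 this).resolve_left (by norm_num))
  rw [e1, eq_neg_iff_add_eq_zero, ← two_smul ℂ] at e2
  rw [e1]
  exact (smul_eq_zero.1 e2).resolve_left two_ne_zero

/-- Bracketing `[aᵢ, bⱼ] = cₙ₊₁` with `c₀` makes `[aᵢ, bⱼ]`, for `i + j = n + 2`, an arithmetic
progression in `i`, whose difference is `[c₀, cₙ₊₁] / 2`. Comparing this with the value of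
`[c₀, cₙ₊₁] = [[x, y], cₙ₊₁]` given by the Jacobi identity forces the difference to vanish. -/
theorem lie_serreC_zero_serreC_succ {n : ℕ} (H : ∀ k ≤ n, SerreTable x y k)
    (hA : ⁅x, serreA x y (n + 1)⁆ = 0) (hB : ⁅y, serreB x y (n + 1)⁆ = 0) :
    ⁅serreC x y 0, serreC x y (n + 1)⁆ = 0 := by
  have F := lie_serreA_serreB_succ H
  have ca : ∀ k ≤ n + 1, ⁅serreC x y 0, serreA x y k⁆ = (2 : ℂ) • serreA x y (k + 1) := by
    intro k hk
    rcases Nat.lt_or_ge n k with h | h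
    · obtain rfl : k = n + 1 := by omega
      have e : ⁅y, serreA x y (n + 1)⁆ = -serreC x y (n + 1) := by
        rw [← F (n + 1) 0 rfl, ← lie_skew, serreB]
      rw [serreC, serreB, lie_lie, e, hA, lie_zero, lie_neg, lie_left_serreC]
      module
    · exact (H k h).ca
  have cb : ∀ k ≤ n + 1, ⁅serreC x y 0, serreB x y k⁆ = (-2 : ℂ) • serreB x y (k + 1) := by
    intro k hk
    rcases Nat.lt_or_ge n k with h | h
    · obtain rfl : k = n + 1 := by omega
      rw [serreC, serreB, lie_lie, hB, ← serreC, lie_zero, lie_right_serreC]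
      module
    · exact (H k h).cb
  set z := ⁅serreC x y 0, serreC x y (n + 1)⁆ with hz
  have step : ∀ i j, i + j = n + 1 → z = (2 : ℂ) • ⁅serreA x y (i + 1), serreB x y j⁆
      - (2 : ℂ) • ⁅serreA x y i, serreB x y (j + 1)⁆ := by
    intro i j hij
    rw [hz, ← F i j hij, leibniz_lie, ca i (by omega), cb j (by omega), smul_lie, lie_smul]
    module
  have prog : ∀ i j, i + j = n + 2 → (2 : ℂ) • ⁅serreA x y i, serreB x y j⁆
      = (2 : ℂ) • serreC x y (n + 2) + (i : ℂ) • z := by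
    intro i
    induction i with
    | zero =>
      intro j hj
      obtain rfl : j = n + 2 := by omega
      simp [serreA, serreC]
    | succ i ih =>
      intro j hij
      have h1 := step i j (by omega)
      have h2 := ih (j + 1) (by omega)
      rw [Nat.cast_add_one]
      linear_combination (norm := module) h2 - h1
  have jac : z = (-2 : ℂ) • ⁅serreA x y (n + 2), y⁆ + (2 : ℂ) • serreC x y (n + 2) := by
    rw [hz, serreC, serreB, lie_lie, lie_right_serreC, lie_left_serreC, lie_smul, lie_smul,
      ← serreC, ← lie_skew _ y]
    module
  -- The last term of the progression turns this into `z = -(n + 2) z`.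
  have last := prog (n + 2) 0 rfl
  rw [serreB] at last
  have : ((n + 3 : ℕ) : ℂ) • z = 0 := by
    have e : z + (2 : ℂ) • ⁅serreA x y (n + 2), y⁆ = (2 : ℂ) • serreC x y (n + 2) := by
      nth_rw 1 [jac]; module
    rw [last] at e
    have e' : z + ((n + 2 : ℕ) : ℂ) • z = 0 := by
      rw [add_left_comm] at e
      exact add_eq_left.1 e
    rw [← e']; push_cast; module
  exact (smul_eq_zero.1 this).resolve_left (Nat.cast_ne_zero.2 (by omega))

theorem serreTable (hx : ⁅x, ⁅x, ⁅x, y⁆⁆⁆ = 0) (hy : ⁅y, ⁅y, ⁅y, x⁆⁆⁆ = 0) (n : ℕ) :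
    SerreTable x y n := by
  induction n using Nat.strong_induction_on with
  | _ n ih =>
    obtain _ | n := n
    · exact serreTable_zero
    have H : ∀ k ≤ n, SerreTable x y k := fun k hk ↦ ih k (by omega)
    have hA := lie_left_serreA_succ hx H
    have hB := lie_right_serreB_succ hy H
    exact ⟨hA, hB, lie_serreA_serreB_succ H, lie_serreC_zero_serreC_succ H hA hB⟩

/-- Indices for the positive roots of `A₁⁽¹⁾`: the real roots `a k = (k + 1, k)` and
`b k = (k, k + 1)`, and the imaginary roots `c k = (k + 1, k + 1)`. -/
inductive Idx
  | a (k : ℕ)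
  | b (k : ℕ)
  | c (k : ℕ)

namespace Idx

/-- The coefficient of the first simple root. -/
def p : Idx → ℕ
  | a k => k + 1
  | b k => k
  | c k => k + 1

/-- The coefficient of the second simple root. -/
def q : Idx → ℕ
  | a k => k
  | b k => k + 1
  | c k => k + 1

/-- The sum of two roots; the value is arbitrary where the sum is not a root. -/
def add : Idx → Idx → Idx
  | a i, b j => c (i + j)
  | b i, a j => c (i + j)
  | a i, c j => a (i + j + 1)
  | c i, a j => a (i + j + 1)
  | b i, c j => b (i + j + 1)
  | c i, b j => b (i + j + 1)
  | i, _ => i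

/-- The structure constants: the bracket of the elements attached to `i` and `j` is `coeff i j`
times the element attached to `add i j`. -/
def coeff : Idx → Idx → ℂ
  | a _, b _ => 1
  | b _, a _ => -1
  | a _, c _ => -2
  | c _, a _ => 2
  | b _, c _ => 2
  | c _, b _ => -2
  | _, _ => 0

theorem ext_pq {i j : Idx} (hp : i.p = j.p) (hq : i.q = j.q) : i = j := by
  cases i <;> cases j <;> simp only [p, q] at hp hq <;> grind

theorem pq_ne_zero (i : Idx) : ¬ (i.p = 0 ∧ i.q = 0) := by
  cases i <;> simp [p, q]

theorem diff_le_one (i : Idx) : diff i.p i.q ≤ 1 := by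
  cases i <;> simp only [p, q, diff] <;> omega

/-- When the sum of two roots is a root, the structure constant vanishes precisely when both
roots are imaginary. -/
theorem coeff_eq_zero_iff {i j k : Idx} (hp : k.p = i.p + j.p) (hq : k.q = i.q + j.q) :
    coeff i j = 0 ↔ diff i.p i.q + diff j.p j.q = 0 := by
  cases i <;> cases j <;> cases k <;> simp only [p, q, coeff, diff] at hp hq ⊢ <;>
    first | omega | (norm_num; try omega)

theorem add_eq {i j k : Idx} (hp : k.p = i.p + j.p) (hq : k.q = i.q + j.q)
    (h : coeff i j ≠ 0) : add i j = k := by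
  cases i <;> cases j <;> simp only [coeff, ne_eq, not_true_eq_false] at h <;>
    refine ext_pq ?_ ?_ <;> simp only [p, q, add] at hp hq ⊢ <;> omega

end Idx

/-- The element of a Lie algebra generated by `x` and `y` that is attached to a root. -/
def serreVec (x y : L) : Idx → L
  | .a k => serreA x y k
  | .b k => serreB x y k
  | .c k => serreC x y k

/-- The multiplication table of the positive part of `A₁⁽¹⁾`. -/
theorem lie_serreVec (hx : ⁅x, ⁅x, ⁅x, y⁆⁆⁆ = 0) (hy : ⁅y, ⁅y, ⁅y, x⁆⁆⁆ = 0) (i j : Idx) :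
    ⁅serreVec x y i, serreVec x y j⁆ = i.coeff j • serreVec x y (i.add j) := by
  have H := serreTable hx hy
  have ab : ∀ i j, ⁅serreA x y i, serreB x y j⁆ = serreC x y (i + j) :=
    fun i j ↦ (H (i + j)).ab i j rfl
  have ca : ∀ i j, ⁅serreC x y i, serreA x y j⁆ = (2 : ℂ) • serreA x y (i + j + 1) := by
    intro i j
    nth_rw 1 [serreC]
    rw [lie_lie, (H j).xa, lie_zero, ← lie_skew (serreB x y i), ab, lie_neg, lie_left_serreC,
      add_comm i j]
    module
  have cb : ∀ i j, ⁅serreC x y i, serreB x y j⁆ = (-2 : ℂ) • serreB x y (i + j + 1) := by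
    intro i j
    nth_rw 1 [← (H i).ab i 0 rfl]
    rw [serreB, lie_lie, (H j).yb, lie_zero, ab, lie_right_serreC]
    module
  have aa : ∀ i j, ⁅serreA x y i, serreA x y j⁆ = 0 := by
    intro i j
    obtain _ | j := j
    · rw [← lie_skew]
      exact neg_eq_zero.2 (H i).xa
    · rw [serreA_succ, lie_smul, leibniz_lie, ← lie_skew _ x, (H i).xa, neg_zero, zero_lie, zero_add,
        ← lie_skew (serreA x y i), ca, lie_neg, lie_smul, (H _).xa]
      simp
  have bb : ∀ i j, ⁅serreB x y i, serreB x y j⁆ = 0 := by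
    intro i j
    obtain _ | j := j
    · rw [← lie_skew]
      exact neg_eq_zero.2 (H i).yb
    · rw [serreB_succ, ← serreC]
      rw [lie_smul, leibniz_lie, ← lie_skew _ y, (H i).yb, neg_zero, zero_lie, zero_add,
        ← lie_skew (serreB x y i), cb, lie_neg, lie_smul, (H _).yb]
      simp
  have cc : ∀ i j, ⁅serreC x y i, serreC x y j⁆ = 0 := by
    intro i j
    nth_rw 1 [serreC]
    rw [lie_lie, lie_left_serreC, ← lie_skew _ (serreC x y j), cb, lie_smul,
      ← lie_skew _ (serreA x y _), ab, ← neg_smul, lie_smul, ← serreC, show j + i + 1 = j + 1 + i by omega]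
    module
  cases i <;> cases j <;> simp only [serreVec, Idx.coeff, Idx.add, aa, bb, cc, ab, ca, cb,
    one_smul, zero_smul]
  · rename_i i j
    rw [← lie_skew, ca, add_comm j i, neg_smul]
  · rw [← lie_skew, ab, add_comm]; module
  · rename_i i j
    rw [← lie_skew, cb, add_comm j i, neg_smul, neg_neg]

/-- By `lie_serreVec` the span of the elements attached to the roots is a subalgebra, which is
everything if `x` and `y` generate. -/
theorem span_serreVec (hx : ⁅x, ⁅x, ⁅x, y⁆⁆⁆ = 0) (hy : ⁅y, ⁅y, ⁅y, x⁆⁆⁆ = 0)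
    (hgen : LieSubalgebra.lieSpan ℂ L {x, y} = ⊤) :
    Submodule.span ℂ (Set.range (serreVec x y)) = ⊤ := by
  let S : LieSubalgebra ℂ L :=
    { Submodule.span ℂ (Set.range (serreVec x y)) with
      lie_mem' := by
        intro u v hu hv
        change u ∈ Submodule.span ℂ _ at hu
        change v ∈ Submodule.span ℂ _ at hv
        change _ ∈ Submodule.span ℂ _
        induction hu, hv using Submodule.span_induction₂ with
        | mem_mem u v hu hv =>
          obtain ⟨i, rfl⟩ := hu
          obtain ⟨j, rfl⟩ := hv
          rw [lie_serreVec hx hy]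
          exact Submodule.smul_mem _ _ (Submodule.subset_span ⟨_, rfl⟩)
        | zero_left => simp
        | zero_right => simp
        | add_left u v w _ _ _ h1 h2 => rw [add_lie]; exact add_mem h1 h2
        | add_right u v w _ _ _ h1 h2 => rw [lie_add]; exact add_mem h1 h2
        | smul_left r u v _ _ h => rw [smul_lie]; exact Submodule.smul_mem _ _ h
        | smul_right r u v _ _ h => rw [lie_smul]; exact Submodule.smul_mem _ _ h }
  have hS : S = ⊤ := by
    rw [eq_top_iff, ← hgen, LieSubalgebra.lieSpan_le]
    rintro _ (rfl | rfl)
    · exact Submodule.subset_span ⟨.a 0, rfl⟩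
    · exact Submodule.subset_span ⟨.b 0, rfl⟩
  have := congrArg LieSubalgebra.toSubmodule hS
  simpa [S] using this

theorem map_serreVec {L' : Type*} [LieRing L'] [LieAlgebra ℂ L'] (φ : L →ₗ⁅ℂ⁆ L') (i : Idx) :
    φ (serreVec x y i) = serreVec (φ x) (φ y) i := by
  have hb : ∀ k, φ (serreB x y k) = serreB (φ x) (φ y) k := by
    intro k
    induction k with
    | zero => rfl
    | succ k ih => simp only [serreB, map_smul, LieHom.map_lie, ih]
  cases i with
  | a k => cases k <;> simp [serreVec, serreA, serreC, hb]
  | b k => exact hb k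
  | c k => simp [serreVec, serreC, hb]

/-- The elements attached to the roots are weight vectors for every derivation that has `x` and
`y` as eigenvectors. -/
theorem derivation_serreVec (D : L →ₗ[ℂ] L) (hD : ∀ u v, D ⁅u, v⁆ = ⁅D u, v⁆ + ⁅u, D v⁆)
    {α β : ℂ} (hx : D x = α • x) (hy : D y = β • y) (i : Idx) :
    D (serreVec x y i) = (i.p • α + i.q • β) • serreVec x y i := by
  have hb : ∀ k : ℕ, D (serreB x y k) = (k * α + (k + 1) * β) • serreB x y k := by
    intro k
    induction k with
    | zero => simp [serreB, hy]
    | succ k ih =>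
      simp only [serreB, map_smul, hD, ih, hx, hy, smul_lie, lie_smul, lie_add]
      push_cast
      module
  have hc : ∀ k : ℕ, D (serreC x y k) = ((k + 1) * α + (k + 1) * β) • serreC x y k := by
    intro k
    simp only [serreC, hD, hx, hb, smul_lie, lie_smul]
    module
  cases i with
  | a k =>
    obtain _ | k := k
    · simp [serreVec, serreA, hx, Idx.p, Idx.q]
    · simp only [serreVec, serreA, map_smul, hD, hx, hc, smul_lie, lie_smul, Idx.p, Idx.q,
        nsmul_eq_mul]
      push_cast
      module
  | b k => simpa [serreVec, Idx.p, Idx.q] using hb k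
  | c k => simpa [serreVec, Idx.p, Idx.q] using hc k

end Serre

/-! ### Diagonal actions and invariant representatives -/

section Diagonal

variable {T V : Type*} [AddCommGroup T] [Module ℂ T] [AddCommGroup V] [Module ℂ V]

theorem IsDiagonal.induction {ρ : T →ₗ[ℂ] Module.End ℂ V} (h : IsDiagonal ρ) {P : V → Prop}
    (mem : ∀ χ, ∀ v ∈ weightSpace ρ χ, P v) (zero : P 0)
    (add : ∀ v w, P v → P w → P (v + w)) (v : V) : P v :=
  Submodule.iSup_induction (weightSpace ρ) (motive := P)
    (by rw [show ⨆ χ, weightSpace ρ χ = ⊤ from h]; trivial) mem zero add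

theorem IsDiagonal.commute {ρ : T →ₗ[ℂ] Module.End ℂ V} (h : IsDiagonal ρ) (s t : T) :
    Commute (ρ s) (ρ t) := by
  refine LinearMap.ext fun v ↦ ?_
  induction v using h.induction with
  | zero => simp only [map_zero]
  | mem χ v hv => simp [hv s, hv t, smul_comm (χ s)]
  | add v w hv hw => rw [map_add, map_add, hv, hw]

theorem IsDiagonal.isSemisimple [FiniteDimensional ℂ V] {ρ : T →ₗ[ℂ] Module.End ℂ V}
    (h : IsDiagonal ρ) (t : T) : (ρ t).IsSemisimple := by
  classical
  set s := (Module.End.finite_hasEigenvalue (ρ t)).toFinset with hs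
  refine Module.End.isSemisimple_of_squarefree_aeval_eq_zero
    (p := ∏ μ ∈ s, (Polynomial.X - Polynomial.C μ)) ?_ ?_
  · exact (Polynomial.separable_prod_X_sub_C_iff'.2 fun _ _ _ _ h ↦ h).squarefree
  · refine LinearMap.ext fun v ↦ ?_
    induction v using h.induction with
    | zero => simp only [map_zero]
    | mem χ v hv =>
      by_cases hv0 : v = 0
      · rw [hv0, map_zero, map_zero]
      have he : Module.End.HasEigenvector (ρ t) (χ t) v :=
        ⟨Module.End.mem_eigenspace_iff.2 (hv t), hv0⟩
      rw [Module.End.aeval_apply_of_hasEigenvector he, Polynomial.eval_prod,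
        Finset.prod_eq_zero (i := χ t), zero_smul]
      · rfl
      · rw [hs, Set.Finite.mem_toFinset]
        exact Module.End.hasEigenvalue_of_hasEigenvector he
      · simp
    | add v w hv hw => rw [map_add, map_add, hv, hw]

/-- For a semisimple endomorphism `θ`, a vector that is killed by `θ` modulo an invariant subspace
`B` is congruent modulo `B` to a vector that is killed by `θ`. The latter is a polynomial in `θ`
applied to the given vector, so it is killed by all that kills the given vector and commutes
with `θ`. -/
theorem exists_ker_sub_mem [FiniteDimensional ℂ V] {θ : Module.End ℂ V} (hθ : θ.IsSemisimple)
    {B : Submodule ℂ V} (hB : ∀ b ∈ B, θ b ∈ B) {f : V} (hf : θ f ∈ B) :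
    ∃ f₀, θ f₀ = 0 ∧ f - f₀ ∈ B ∧ ∀ φ : Module.End ℂ V, Commute φ θ → φ f = 0 → φ f₀ = 0 := by
  -- As `minpoly θ` is squarefree, it divides `X * q` for some `q` that is coprime to `X`.
  obtain ⟨q, hq, a, b, hab⟩ : ∃ q, minpoly ℂ θ ∣ Polynomial.X * q ∧ IsCoprime Polynomial.X q := by
    by_cases hX : Polynomial.X ∣ minpoly ℂ θ
    · obtain ⟨q, hq⟩ := hX
      refine ⟨q, hq.dvd, ?_⟩
      rw [(Polynomial.irreducible_X).coprime_iff_not_dvd]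
      rintro ⟨r, rfl⟩
      refine Polynomial.irreducible_X.not_isUnit (hθ.minpoly_squarefree _ ⟨r, ?_⟩)
      rw [hq, mul_assoc]
    · exact ⟨minpoly ℂ θ, dvd_mul_left _ _,
        (Polynomial.irreducible_X.coprime_iff_not_dvd).2 hX⟩
  have h0 : Polynomial.aeval θ (Polynomial.X * q) = 0 := by
    obtain ⟨r, hr⟩ := hq
    rw [hr, map_mul, minpoly.aeval, zero_mul]
  have hpoly : ∀ p : Polynomial ℂ, ∀ v ∈ B, Polynomial.aeval θ p v ∈ B := by
    intro p v hv
    induction p using Polynomial.induction_on' with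
    | add p r hp hr => rw [map_add]; exact add_mem hp hr
    | monomial n c =>
      rw [Polynomial.aeval_monomial, Module.End.mul_apply, Module.algebraMap_end_apply]
      refine B.smul_mem _ ?_
      induction n with
      | zero => simpa using hv
      | succ n ih => rw [pow_succ', Module.End.mul_apply]; exact hB _ ih
  refine ⟨Polynomial.aeval θ (b * q) f, ?_, ?_, fun φ hφ hf0 ↦ ?_⟩
  · have : Polynomial.aeval θ (Polynomial.X * (b * q)) = 0 := by
      rw [mul_left_comm, map_mul, h0, mul_zero]
    rw [map_mul, Polynomial.aeval_X] at this
    exact LinearMap.congr_fun this f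
  · have e : f = Polynomial.aeval θ (a * Polynomial.X + b * q) f := by rw [hab]; simp
    nth_rw 1 [e]
    rw [map_add, LinearMap.add_apply, add_sub_cancel_right, map_mul, Polynomial.aeval_X]
    exact hpoly a _ hf
  · have : Commute φ (Polynomial.aeval θ (b * q)) := by
      generalize b * q = p
      induction p using Polynomial.induction_on' with
      | add p r hp hr => rw [map_add]; exact hp.add_right hr
      | monomial n c =>
        rw [Polynomial.aeval_monomial]
        exact (show Commute φ _ from (Algebra.commutes c φ).symm).mul_right (hφ.pow_right n)
    rw [← Module.End.mul_apply, this.eq, Module.End.mul_apply, hf0, map_zero]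

/-- A vector that is invariant modulo `B` under commuting semisimple endomorphisms is congruent
modulo `B` to an invariant vector. -/
theorem exists_invariant_sub_mem [FiniteDimensional ℂ V] [FiniteDimensional ℂ T]
    {θ : T →ₗ[ℂ] Module.End ℂ V} (hθ : ∀ t, (θ t).IsSemisimple)
    (hcomm : ∀ s t, Commute (θ s) (θ t)) {B : Submodule ℂ V} (hB : ∀ t, ∀ b ∈ B, θ t b ∈ B)
    {f : V} (hf : ∀ t, θ t f ∈ B) : ∃ f₀, (∀ t, θ t f₀ = 0) ∧ f - f₀ ∈ B := by
  classical
  have key : ∀ s : Finset T, ∃ f₀, (∀ t ∈ s, θ t f₀ = 0) ∧ f - f₀ ∈ B := by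
    intro s
    induction s using Finset.induction_on with
    | empty => exact ⟨f, by simp, by simp⟩
    | insert t s _ ih =>
      obtain ⟨f₁, h1, h2⟩ := ih
      have hf1 : θ t f₁ ∈ B := by
        have := B.sub_mem (hf t) (hB t _ h2)
        rwa [map_sub, sub_sub_cancel] at this
      obtain ⟨f₀, h3, h4, h5⟩ := exists_ker_sub_mem (hθ t) (hB t) hf1
      refine ⟨f₀, fun r hr ↦ ?_, by simpa using B.add_mem h2 h4⟩
      rcases Finset.mem_insert.1 hr with rfl | hr
      · exact h3
      · exact h5 _ (hcomm _ _) (h1 r hr)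
  obtain ⟨s, hs⟩ := Module.Finite.fg_top (R := ℂ) (M := T)
  obtain ⟨f₀, h1, h2⟩ := key s
  refine ⟨f₀, fun t ↦ ?_, h2⟩
  have ht : t ∈ Submodule.span ℂ (s : Set T) := by rw [hs]; trivial
  induction ht using Submodule.span_induction with
  | mem t ht => exact h1 t ht
  | zero => simp
  | add u v _ _ hu hv => rw [map_add, LinearMap.add_apply, hu, hv, add_zero]
  | smul c u _ hu => rw [map_smul, LinearMap.smul_apply, hu, smul_zero]

end Diagonal

section BilinAction

variable {T L M : Type*} [AddCommGroup T] [Module ℂ T] [AddCommGroup L] [Module ℂ L]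
  [AddCommGroup M] [Module ℂ M]

variable (L M) in
/-- Composition of a bilinear map with an endomorphism of the target. -/
def bilinPost : Module.End ℂ M →ₗ[ℂ] Module.End ℂ (L →ₗ[ℂ] L →ₗ[ℂ] M) where
  toFun E :=
    { toFun f := f.compr₂ E
      map_add' f g := by ext; simp
      map_smul' c f := by ext; simp }
  map_add' E F := by ext; simp
  map_smul' c E := by ext; simp

variable (L M) in
/-- Composition of the first argument of a bilinear map with an endomorphism. -/
def bilinPreLeft : Module.End ℂ L →ₗ[ℂ] Module.End ℂ (L →ₗ[ℂ] L →ₗ[ℂ] M) where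
  toFun D :=
    { toFun f := f ∘ₗ D
      map_add' f g := by ext; simp
      map_smul' c f := by ext; simp }
  map_add' D E := by ext; simp
  map_smul' c D := by ext; simp

variable (L M) in
/-- Composition of the second argument of a bilinear map with an endomorphism. -/
def bilinPreRight : Module.End ℂ L →ₗ[ℂ] Module.End ℂ (L →ₗ[ℂ] L →ₗ[ℂ] M) where
  toFun D :=
    { toFun f := f.compl₂ D
      map_add' f g := by ext; simp
      map_smul' c f := by ext; simp }
  map_add' D E := by ext; simp
  map_smul' c D := by ext; simp

/-- The action `(t • f)(x, y) = t • f(x, y) - f(t • x, y) - f(x, t • y)` on bilinear maps. -/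
def bilinAction (D : T →ₗ[ℂ] Module.End ℂ L) (E : T →ₗ[ℂ] Module.End ℂ M) :
    T →ₗ[ℂ] Module.End ℂ (L →ₗ[ℂ] L →ₗ[ℂ] M) where
  toFun t := bilinPost L M (E t) - bilinPreLeft L M (D t) - bilinPreRight L M (D t)
  map_add' s t := by simp only [map_add]; abel
  map_smul' c t := by ext f x y; simp [smul_sub]

theorem bilinAction_apply (D : T →ₗ[ℂ] Module.End ℂ L) (E : T →ₗ[ℂ] Module.End ℂ M) (t : T)
    (f : L →ₗ[ℂ] L →ₗ[ℂ] M) (x y : L) :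
    bilinAction D E t f x y = E t (f x y) - f (D t x) y - f x (D t y) := rfl

theorem bilinAction_commute {D : T →ₗ[ℂ] Module.End ℂ L} {E : T →ₗ[ℂ] Module.End ℂ M}
    (hD : ∀ s t, Commute (D s) (D t)) (hE : ∀ s t, Commute (E s) (E t)) (s t : T) :
    Commute (bilinAction D E s) (bilinAction D E t) := by
  refine LinearMap.ext fun f ↦ LinearMap.ext fun x ↦ LinearMap.ext fun y ↦ ?_
  have h1 : ∀ m, E s (E t m) = E t (E s m) := fun m ↦ LinearMap.congr_fun (hE s t).eq m
  have h2 : ∀ x, D s (D t x) = D t (D s x) := fun x ↦ LinearMap.congr_fun (hD s t).eq x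
  simp only [Module.End.mul_apply, bilinAction_apply, map_sub, h1, h2]
  abel

/-- A linear map between endomorphism algebras that is multiplicative on the powers of `D` maps a
semisimple `D` to a semisimple endomorphism, as `minpoly D` annihilates the image. -/
theorem isSemisimple_of_pow {A U : Type*} [AddCommGroup U] [Module ℂ U] [FiniteDimensional ℂ U]
    [AddCommGroup A] [Module ℂ A] [FiniteDimensional ℂ A]
    (Φ : Module.End ℂ U →ₗ[ℂ] Module.End ℂ A) (h1 : Φ 1 = 1) {D : Module.End ℂ U}
    (h : ∀ n, Φ (D ^ (n + 1)) = Φ D * Φ (D ^ n)) (hD : D.IsSemisimple) : (Φ D).IsSemisimple := by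
  refine Module.End.isSemisimple_of_squarefree_aeval_eq_zero hD.minpoly_squarefree ?_
  have hpow : ∀ n, Φ (D ^ n) = Φ D ^ n := by
    intro n
    induction n with
    | zero => simp [h1]
    | succ n ih => rw [h, ih, pow_succ']
  have : ∀ p : Polynomial ℂ, Polynomial.aeval (Φ D) p = Φ (Polynomial.aeval D p) := by
    intro p
    induction p using Polynomial.induction_on' with
    | add p r hp hr => simp only [map_add, hp, hr]
    | monomial n c =>
      simp only [Polynomial.aeval_monomial, ← Algebra.smul_def, map_smul, hpow]
  rw [this, minpoly.aeval, map_zero]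

theorem isSemisimple_bilinAction [FiniteDimensional ℂ L] [FiniteDimensional ℂ M]
    {D : T →ₗ[ℂ] Module.End ℂ L} {E : T →ₗ[ℂ] Module.End ℂ M} {t : T}
    (hD : (D t).IsSemisimple) (hE : (E t).IsSemisimple) : (bilinAction D E t).IsSemisimple := by
  have s1 := isSemisimple_of_pow (bilinPost L M) rfl (fun n ↦ by rw [pow_succ']; rfl) hE
  have s2 := isSemisimple_of_pow (bilinPreLeft L M) rfl (fun n ↦ by rw [pow_succ]; rfl) hD
  have s3 := isSemisimple_of_pow (bilinPreRight L M) rfl (fun n ↦ by rw [pow_succ]; rfl) hD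
  have c12 : Commute (bilinPost L M (E t)) (bilinPreLeft L M (D t)) := rfl
  have c : Commute (bilinPost L M (E t) - bilinPreLeft L M (D t)) (bilinPreRight L M (D t)) :=
    LinearMap.ext fun f ↦ LinearMap.ext fun x ↦ LinearMap.ext fun y ↦ rfl
  exact (s1.sub_of_commute c12 s2).sub_of_commute c s3

end BilinAction

/-! ### Generators of the nilpotent algebra -/

section Derivations

variable {T L : Type*} [AddCommGroup T] [Module ℂ T] [LieRing L] [LieAlgebra ℂ L]

theorem lie_mem_weightSpace {ρ : T →ₗ[ℂ] Module.End ℂ L}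
    (hρ : ∀ t u v, ρ t ⁅u, v⁆ = ⁅ρ t u, v⁆ + ⁅u, ρ t v⁆) {α β : Module.Dual ℂ T} {x y : L}
    (hx : x ∈ weightSpace ρ α) (hy : y ∈ weightSpace ρ β) : ⁅x, y⁆ ∈ weightSpace ρ (α + β) := by
  intro t
  rw [hρ, hx t, hy t, smul_lie, lie_smul, LinearMap.add_apply, add_smul]

theorem serreVec_mem_weightSpace {ρ : T →ₗ[ℂ] Module.End ℂ L}
    (hρ : ∀ t u v, ρ t ⁅u, v⁆ = ⁅ρ t u, v⁆ + ⁅u, ρ t v⁆) {α β : Module.Dual ℂ T} {x y : L}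
    (hx : x ∈ weightSpace ρ α) (hy : y ∈ weightSpace ρ β) (i : Idx) :
    serreVec x y i ∈ weightSpace ρ (i.p • α + i.q • β) := by
  intro t
  rw [derivation_serreVec (ρ t) (hρ t) (hx t) (hy t)]
  rfl

/-- The Serre element lies in the weight space of weight `3 α + β`. -/
theorem serre_mem_weightSpace {ρ : T →ₗ[ℂ] Module.End ℂ L}
    (hρ : ∀ t u v, ρ t ⁅u, v⁆ = ⁅ρ t u, v⁆ + ⁅u, ρ t v⁆) {α β : Module.Dual ℂ T} {x y : L}
    (hx : x ∈ weightSpace ρ α) (hy : y ∈ weightSpace ρ β) :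
    ⁅x, ⁅x, ⁅x, y⁆⁆⁆ ∈ weightSpace ρ (3 • α + β) := by
  have := lie_mem_weightSpace hρ hx (lie_mem_weightSpace hρ hx (lie_mem_weightSpace hρ hx hy))
  rwa [show α + (α + (α + β)) = 3 • α + β by abel] at this

/-- A derivation that kills a set of generators is zero. -/
theorem derivation_eq_zero {M : Type*} [AddCommGroup M] [Module ℂ M] [LieRingModule L M]
    [LieModule ℂ L M] {D : L →ₗ[ℂ] M} (hD : ∀ u v, D ⁅u, v⁆ = ⁅u, D v⁆ - ⁅v, D u⁆)
    {s : Set L} (hs : LieSubalgebra.lieSpan ℂ L s = ⊤) (h : ∀ x ∈ s, D x = 0) : D = 0 := by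
  let K : LieSubalgebra ℂ L :=
    { LinearMap.ker D with
      lie_mem' := by
        intro u v hu hv
        change D u = 0 at hu
        change D v = 0 at hv
        change D ⁅u, v⁆ = 0
        rw [hD, hu, hv, lie_zero, lie_zero, sub_zero] }
  have hK : K = ⊤ := by
    rw [eq_top_iff, ← hs, LieSubalgebra.lieSpan_le]
    exact h
  ext x
  have : x ∈ K := by rw [hK]; trivial
  exact this

end Derivations

section Nilpotent

variable {N : Type*} [LieRing N] [LieAlgebra ℂ N]

theorem mem_derivedIdeal_induction {P : N → Prop} (lie : ∀ x y : N, P ⁅x, y⁆) (zero : P 0)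
    (add : ∀ x y, P x → P y → P (x + y)) (smul : ∀ (c : ℂ) x, P x → P (c • x)) {x : N}
    (hx : x ∈ derivedIdeal N) : P x := by
  rw [← LieSubmodule.mem_toSubmodule, LieSubmodule.lieIdeal_oper_eq_linear_span'] at hx
  induction hx using Submodule.span_induction with
  | mem z hz => obtain ⟨x, -, y, -, rfl⟩ := hz; exact lie x y
  | zero => exact zero
  | add u v _ _ hu hv => exact add u v hu hv
  | smul c u _ hu => exact smul c u hu

theorem lie_mem_derivedIdeal (x y : N) : ⁅x, y⁆ ∈ derivedIdeal N :=
  LieSubmodule.lie_mem_lie (LieSubmodule.mem_top x) (LieSubmodule.mem_top y)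

/-- In a nilpotent Lie algebra, representatives of `N / N²` generate. -/
theorem lieSpan_eq_top_of_nilpotent [LieRing.IsNilpotent N] {s : Set N}
    (h : ∀ x, ∃ u ∈ LieSubalgebra.lieSpan ℂ N s, x - u ∈ derivedIdeal N) :
    LieSubalgebra.lieSpan ℂ N s = ⊤ := by
  set K := LieSubalgebra.lieSpan ℂ N s
  have key : ∀ k, ∀ x, ∃ u ∈ K, x - u ∈ LieModule.lowerCentralSeries ℂ N N (k + 1) := by
    intro k
    induction k with
    | zero => exact h
    | succ k ih =>
      have hN : ∀ n ∈ derivedIdeal N,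
          ∃ u ∈ K, n - u ∈ LieModule.lowerCentralSeries ℂ N N (k + 1 + 1) := by
        intro n hn
        refine mem_derivedIdeal_induction (P := fun n ↦ ∃ u ∈ K,
          n - u ∈ LieModule.lowerCentralSeries ℂ N N (k + 1 + 1)) ?_ ?_ ?_ ?_ hn
        · intro y z
          obtain ⟨u, hu, hyu⟩ := ih y
          obtain ⟨v, hv, hzv⟩ := ih z
          refine ⟨⁅u, v⁆, K.lie_mem hu hv, ?_⟩
          rw [show ⁅y, z⁆ - ⁅u, v⁆ = ⁅y, z - v⁆ - ⁅v, y - u⁆ by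
            rw [lie_sub, lie_sub, ← lie_skew u v, ← lie_skew y v]; abel,
            LieModule.lowerCentralSeries_succ]
          exact sub_mem (LieSubmodule.lie_mem_lie (LieSubmodule.mem_top _) hzv)
            (LieSubmodule.lie_mem_lie (LieSubmodule.mem_top _) hyu)
        · exact ⟨0, K.zero_mem, by rw [sub_zero]; exact zero_mem _⟩
        · rintro x y ⟨u, hu, hxu⟩ ⟨v, hv, hyv⟩
          exact ⟨u + v, K.add_mem hu hv, by rw [add_sub_add_comm]; exact add_mem hxu hyv⟩
        · rintro c x ⟨u, hu, hxu⟩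
          exact ⟨c • u, K.smul_mem c hu, by rw [← smul_sub]; exact SMulMemClass.smul_mem c hxu⟩
      intro x
      obtain ⟨u, hu, hxu⟩ := h x
      obtain ⟨v, hv, hxv⟩ := hN _ hxu
      exact ⟨u + v, K.add_mem hu hv, by rwa [← sub_sub]⟩
  obtain ⟨k, hk⟩ := (LieModule.isNilpotent_iff ℂ N N).1 ‹_›
  rw [eq_top_iff]
  intro x _
  obtain ⟨u, hu, hxu⟩ := key k x
  have : x - u ∈ LieModule.lowerCentralSeries ℂ N N k :=
    LieModule.antitone_lowerCentralSeries ℂ N N (Nat.le_succ k) hxu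
  rw [hk, LieSubmodule.mem_bot, sub_eq_zero] at this
  rwa [this]

end Nilpotent

section Generators

variable {N : Type*} [LieRing N] [LieAlgebra ℂ N]
variable {T : LieSubalgebra ℂ (LieDerivation ℂ N N)}

theorem derAction_eq_zero {t : T} (h : derAction T t = 0) : t = 0 :=
  Subtype.ext (LieDerivation.ext fun x ↦ LinearMap.congr_fun h x)

theorem derAction_mem_derivedIdeal (t : T) {x : N} (hx : x ∈ derivedIdeal N) :
    derAction T t x ∈ derivedIdeal N := by
  refine mem_derivedIdeal_induction (P := fun x ↦ derAction T t x ∈ derivedIdeal N)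
    (fun x y ↦ ?_) ?_ (fun x y hx hy ↦ ?_) (fun c x hx ↦ ?_) hx
  · rw [derAction_lie]
    exact add_mem (lie_mem_derivedIdeal _ _) (lie_mem_derivedIdeal _ _)
  · rw [map_zero]; exact zero_mem _
  · rw [map_add]; exact add_mem hx hy
  · rw [map_smul]; exact SMulMemClass.smul_mem c hx

/-- Root vectors `e₁`, `e₂` that generate `N` and the basis `t₁`, `t₂` of `T` that is dual to their
roots `α₁`, `α₂`, where `3 α₁ + α₂` and `α₁ + 3 α₂` are not roots. -/
structure IsGenerating (T : LieSubalgebra ℂ (LieDerivation ℂ N N)) (α₁ α₂ : Module.Dual ℂ T)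
    (e₁ e₂ : N) (t₁ t₂ : T) : Prop where
  mem₁ : e₁ ∈ rootSpace T α₁
  mem₂ : e₂ ∈ rootSpace T α₂
  ne₁ : e₁ ≠ 0
  ne₂ : e₂ ≠ 0
  gen : LieSubalgebra.lieSpan ℂ N {e₁, e₂} = ⊤
  h₁₁ : α₁ t₁ = 1
  h₁₂ : α₁ t₂ = 0
  h₂₁ : α₂ t₁ = 0
  h₂₂ : α₂ t₂ = 1
  expand : ∀ t, t = α₁ t • t₁ + α₂ t • t₂
  h31 : 3 • α₁ + α₂ ∉ roots T
  h13 : α₁ + 3 • α₂ ∉ roots T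

theorem derAction_lie' (t : T) (x y : N) :
    derAction T t ⁅x, y⁆ = ⁅x, derAction T t y⁆ - ⁅y, derAction T t x⁆ := by
  rw [derAction_lie, ← lie_skew, sub_eq_add_neg, add_comm]

/-- An element of `T` that is killed by `α₁` and `α₂` kills generators of `N`, so it is zero: the
roots `α₁` and `α₂` form a basis of the dual of `T`. -/
theorem exists_dual_basis (hrank : Module.finrank ℂ T = 2) {α₁ α₂ : Module.Dual ℂ T}
    (hgen : LieSubalgebra.lieSpan ℂ N
      ((rootSpace T α₁ : Set N) ∪ (rootSpace T α₂ : Set N)) = ⊤) :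
    ∃ t₁ t₂ : T, α₁ t₁ = 1 ∧ α₁ t₂ = 0 ∧ α₂ t₁ = 0 ∧ α₂ t₂ = 1 ∧
      ∀ t, t = α₁ t • t₁ + α₂ t • t₂ := by
  have : FiniteDimensional ℂ T := FiniteDimensional.of_finrank_pos (by omega)
  have hinj : Function.Injective (α₁.prod α₂) := by
    rw [← LinearMap.ker_eq_bot, LinearMap.ker_eq_bot']
    intro t ht
    obtain ⟨ht1, ht2⟩ : α₁ t = 0 ∧ α₂ t = 0 := Prod.mk_eq_zero.1 ht
    refine derAction_eq_zero (derivation_eq_zero (derAction_lie' t) hgen ?_)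
    rintro x (hx | hx)
    · rw [hx t, ht1, zero_smul]
    · rw [hx t, ht2, zero_smul]
  have hsurj : Function.Surjective (α₁.prod α₂) :=
    (LinearMap.injective_iff_surjective_of_finrank_eq_finrank (by simp [hrank])).1 hinj
  obtain ⟨t₁, h1⟩ := hsurj (1, 0)
  obtain ⟨t₂, h2⟩ := hsurj (0, 1)
  obtain ⟨h11, h21⟩ : α₁ t₁ = 1 ∧ α₂ t₁ = 0 := Prod.mk.inj h1
  obtain ⟨h12, h22⟩ : α₁ t₂ = 0 ∧ α₂ t₂ = 1 := Prod.mk.inj h2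
  refine ⟨t₁, t₂, h11, h12, h21, h22, fun t ↦ hinj (Prod.ext ?_ ?_)⟩
  · simp [h11, h12]
  · simp [h21, h22]

/-- Primitive root vectors `e₁`, `e₂` have independent classes in the plane `N / N²`, so they
generate `N` by nilpotency. -/
theorem exists_isGenerating [FiniteDimensional ℂ N] [LieRing.IsNilpotent N]
    (hrank : Module.finrank ℂ T = 2) (hmax : Module.finrank ℂ (N ⧸ derivedIdeal N) = 2)
    {α₁ α₂ : Module.Dual ℂ T} (h₁ : IsPrimitive T α₁) (h₂ : IsPrimitive T α₂)
    (hgen : LieSubalgebra.lieSpan ℂ N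
      ((rootSpace T α₁ : Set N) ∪ (rootSpace T α₂ : Set N)) = ⊤)
    (h31 : 3 • α₁ + α₂ ∉ roots T) (h13 : α₁ + 3 • α₂ ∉ roots T) :
    ∃ e₁ e₂ t₁ t₂, IsGenerating T α₁ α₂ e₁ e₂ t₁ t₂ := by
  obtain ⟨t₁, t₂, h11, h12, h21, h22, hexp⟩ := exists_dual_basis hrank hgen
  obtain ⟨e₁, he₁, hn₁⟩ := SetLike.not_le_iff_exists.1 h₁
  obtain ⟨e₂, he₂, hn₂⟩ := SetLike.not_le_iff_exists.1 h₂
  refine ⟨e₁, e₂, t₁, t₂, he₁, he₂, ?_, ?_, ?_, h11, h12, h21, h22, hexp, h31, h13⟩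
  · rintro rfl; exact hn₁ (zero_mem _)
  · rintro rfl; exact hn₂ (zero_mem _)
  -- Applying `t₁` and `t₂` to a relation modulo `N²` isolates its two terms.
  have hli : LinearIndependent ℂ
      ![(LieSubmodule.Quotient.mk e₁ : N ⧸ derivedIdeal N), LieSubmodule.Quotient.mk e₂] := by
    rw [LinearIndependent.pair_iff]
    intro a b hab
    have hmem : a • e₁ + b • e₂ ∈ derivedIdeal N := by
      rw [← LieSubmodule.Quotient.mk_eq_zero]
      exact hab
    have hmem1 := derAction_mem_derivedIdeal t₁ hmem
    have hmem2 := derAction_mem_derivedIdeal t₂ hmem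
    rw [map_add, map_smul, map_smul, he₁, he₂, h11, h21, one_smul, zero_smul, smul_zero,
      add_zero] at hmem1
    rw [map_add, map_smul, map_smul, he₁, he₂, h12, h22, one_smul, zero_smul, smul_zero,
      zero_add] at hmem2
    constructor
    · by_contra h
      exact hn₁ (((derivedIdeal N).toSubmodule.smul_mem_iff h).1 hmem1)
    · by_contra h
      exact hn₂ (((derivedIdeal N).toSubmodule.smul_mem_iff h).1 hmem2)
  have hspan := hli.span_eq_top_of_card_eq_finrank' (by rw [Fintype.card_fin, hmax])
  refine lieSpan_eq_top_of_nilpotent fun x ↦ ?_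
  have hx : (LieSubmodule.Quotient.mk x : N ⧸ derivedIdeal N) ∈ Submodule.span ℂ
      (Set.range ![(LieSubmodule.Quotient.mk e₁ : N ⧸ derivedIdeal N),
        LieSubmodule.Quotient.mk e₂]) := by rw [hspan]; trivial
  rw [Matrix.range_cons, Matrix.range_cons, Matrix.range_empty, Set.union_empty,
    Set.singleton_union, Submodule.mem_span_pair] at hx
  obtain ⟨a, b, hab⟩ := hx
  refine ⟨a • e₁ + b • e₂, ?_, ?_⟩
  · exact add_mem (SMulMemClass.smul_mem a (LieSubalgebra.subset_lieSpan (by simp)))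
      (SMulMemClass.smul_mem b (LieSubalgebra.subset_lieSpan (by simp)))
  · rw [← LieSubmodule.Quotient.mk_eq_zero]
    rw [map_sub, sub_eq_zero]
    exact hab.symm

namespace IsGenerating

variable {α₁ α₂ : Module.Dual ℂ T} {e₁ e₂ : N} {t₁ t₂ : T}
variable (h : IsGenerating T α₁ α₂ e₁ e₂ t₁ t₂)
include h

theorem serre₁ : ⁅e₁, ⁅e₁, ⁅e₁, e₂⁆⁆⁆ = 0 := by
  by_contra h0
  exact h.h31 ((Submodule.ne_bot_iff _).2
    ⟨_, serre_mem_weightSpace (derAction_lie T) h.mem₁ h.mem₂, h0⟩)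

theorem serre₂ : ⁅e₂, ⁅e₂, ⁅e₂, e₁⁆⁆⁆ = 0 := by
  by_contra h0
  refine h.h13 ((Submodule.ne_bot_iff _).2 ⟨_, ?_, h0⟩)
  rw [add_comm]
  exact serre_mem_weightSpace (derAction_lie T) h.mem₂ h.mem₁

theorem coeffs_eq {p q r s : ℕ} (e : p • α₁ + q • α₂ = r • α₁ + s • α₂) : p = r ∧ q = s := by
  have e1 := LinearMap.congr_fun e t₁
  have e2 := LinearMap.congr_fun e t₂
  simp only [LinearMap.add_apply, LinearMap.smul_apply, h.h₁₁, h.h₁₂, h.h₂₁, h.h₂₂, smul_zero,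
    add_zero, zero_add, nsmul_eq_mul, mul_one] at e1 e2
  exact ⟨by exact_mod_cast e1, by exact_mod_cast e2⟩

theorem coeffs_ne_zero {p q : ℕ} (hpq : ¬ (p = 0 ∧ q = 0)) : p • α₁ + q • α₂ ≠ 0 := by
  intro e
  exact hpq (h.coeffs_eq (r := 0) (s := 0) (by simpa using e))

theorem serreVec_mem (i : Idx) : serreVec e₁ e₂ i ∈ rootSpace T (i.p • α₁ + i.q • α₂) :=
  serreVec_mem_weightSpace (derAction_lie T) h.mem₁ h.mem₂ i

theorem span_eq_top : Submodule.span ℂ (Set.range (serreVec e₁ e₂)) = ⊤ :=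
  span_serreVec h.serre₁ h.serre₂ h.gen

/-- The nonzero ones among the elements attached to the roots are eigenvectors of `3 t₁ + t₂` with
distinct eigenvalues: these are `4 k + 3`, `4 k + 1` and `4 k + 4` for the roots `a k`, `b k`
and `c k`. -/
theorem linearIndependent :
    LinearIndependent ℂ (fun i : {i // serreVec e₁ e₂ i ≠ 0} ↦ serreVec e₁ e₂ i) := by
  refine Module.End.eigenvectors_linearIndependent' (derAction T (3 • t₁ + t₂))
    (fun i ↦ ((3 * i.1.p + i.1.q : ℕ) : ℂ)) ?_ _ fun i ↦ ⟨?_, i.2⟩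
  · rintro ⟨i, _⟩ ⟨j, _⟩ hij
    have hij' : 3 * i.p + i.q = 3 * j.p + j.q := Nat.cast_injective (R := ℂ) hij
    refine Subtype.ext (Idx.ext_pq ?_ ?_) <;> cases i <;> cases j <;>
      simp only [Idx.p, Idx.q] at hij' ⊢ <;> omega
  · rw [Module.End.mem_eigenspace_iff, h.serreVec_mem i.1]
    congr 1
    simp only [map_add, map_nsmul, LinearMap.add_apply, LinearMap.smul_apply, h.h₁₁, h.h₁₂,
      h.h₂₁, h.h₂₂, nsmul_eq_mul]
    push_cast
    ring

/-- The basis of `N` that consists of the nonzero elements attached to the roots. -/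
def basis : Module.Basis {i // serreVec e₁ e₂ i ≠ 0} ℂ N :=
  Module.Basis.mk h.linearIndependent (by
    rw [← h.span_eq_top, Submodule.span_le]
    rintro _ ⟨i, rfl⟩
    by_cases hi : serreVec e₁ e₂ i = 0
    · rw [hi]; exact zero_mem _
    · exact Submodule.subset_span ⟨⟨i, hi⟩, rfl⟩)

theorem basis_apply (i : {i // serreVec e₁ e₂ i ≠ 0}) : h.basis i = serreVec e₁ e₂ i :=
  Module.Basis.mk_apply _ _ i

/-- A linear map out of `N` may be prescribed on the elements attached to the roots, subject to
vanishing where they do. -/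
theorem exists_linearMap {V : Type*} [AddCommGroup V] [Module ℂ V] (w : Idx → V)
    (hw : ∀ i, serreVec e₁ e₂ i = 0 → w i = 0) :
    ∃ s : N →ₗ[ℂ] V, ∀ i, s (serreVec e₁ e₂ i) = w i := by
  refine ⟨h.basis.constr ℂ fun i ↦ w i, fun i ↦ ?_⟩
  by_cases hi : serreVec e₁ e₂ i = 0
  · rw [hi, map_zero, hw i hi]
  · rw [← h.basis_apply ⟨i, hi⟩, Module.Basis.constr_basis]

/-- Every root of `N` is a positive root of `A₁⁽¹⁾`, of multiplicity one. -/
theorem exists_eq_smul {μ : Module.Dual ℂ T} {v : N} (hv : v ∈ rootSpace T μ) (hv0 : v ≠ 0) :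
    ∃ i, μ = i.p • α₁ + i.q • α₂ ∧ ∃ c : ℂ, c ≠ 0 ∧ v = c • serreVec e₁ e₂ i := by
  classical
  let b := h.basis
  have hb : ∀ i, b i = serreVec e₁ e₂ i := h.basis_apply
  have hrepr : ∀ t, ∀ w i, b.repr (derAction T t w) i
      = (i.1.p • α₁ + i.1.q • α₂) t * b.repr w i := by
    intro t w i
    have : Finsupp.lapply i ∘ₗ b.repr.toLinearMap ∘ₗ derAction T t
        = ((i.1.p • α₁ + i.1.q • α₂) t) • (Finsupp.lapply i ∘ₗ b.repr.toLinearMap) := by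
      refine b.ext fun j ↦ ?_
      have e : derAction T t (b j) = (j.1.p • α₁ + j.1.q • α₂) t • b j := by
        rw [hb, h.serreVec_mem]
      simp only [LinearMap.comp_apply, LinearMap.smul_apply, e, map_smul]
      by_cases hij : j = i
      · rw [hij]
      · simp [hij]
    exact LinearMap.congr_fun this w
  have hμ : ∀ i, b.repr v i ≠ 0 → μ = i.1.p • α₁ + i.1.q • α₂ := by
    intro i hi
    ext t
    have := hrepr t v i
    rw [hv t, map_smul, Finsupp.smul_apply, smul_eq_mul] at this
    exact mul_right_cancel₀ hi this
  obtain ⟨i, hi⟩ : ∃ i, b.repr v i ≠ 0 := by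
    by_contra! h0
    exact hv0 (b.repr.map_eq_zero_iff.1 (Finsupp.ext h0))
  refine ⟨i, hμ i hi, b.repr v i, hi, b.repr.injective (Finsupp.ext fun j ↦ ?_)⟩
  rw [← hb, map_smul, Finsupp.smul_apply, b.repr_self, Finsupp.single_apply]
  split_ifs with hij
  · rw [hij, smul_eq_mul, mul_one]
  · rw [smul_zero]
    by_contra hj
    have e := h.coeffs_eq ((hμ i hi).symm.trans (hμ j hj))
    exact hij (Subtype.ext (Idx.ext_pq e.1 e.2))

theorem exists_of_mem_roots {μ : Module.Dual ℂ T} (hμ : μ ∈ roots T) :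
    ∃ i, μ = i.p • α₁ + i.q • α₂ ∧ serreVec e₁ e₂ i ≠ 0 := by
  obtain ⟨v, hv, hv0⟩ := (Submodule.ne_bot_iff _).1 hμ
  obtain ⟨i, hi, c, -, rfl⟩ := h.exists_eq_smul hv hv0
  exact ⟨i, hi, fun h0 ↦ hv0 (by rw [h0, smul_zero])⟩

theorem zero_notMem_roots : (0 : Module.Dual ℂ T) ∉ roots T := by
  intro h0
  obtain ⟨i, hi, -⟩ := h.exists_of_mem_roots h0
  exact h.coeffs_ne_zero i.pq_ne_zero hi.symm

theorem existsUnique_coeffs {μ : Module.Dual ℂ T} (hμ : μ ∈ roots T) :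
    ∃! c : ℕ × ℕ, μ = c.1 • α₁ + c.2 • α₂ := by
  obtain ⟨i, hi, -⟩ := h.exists_of_mem_roots hμ
  refine ⟨(i.p, i.q), hi, fun c hc ↦ ?_⟩
  have := h.coeffs_eq (hc.symm.trans hi)
  exact Prod.ext this.1 this.2

theorem diff_le_one {p q : ℕ} (hpq : p • α₁ + q • α₂ ∈ roots T) : diff p q ≤ 1 := by
  obtain ⟨i, hi, -⟩ := h.exists_of_mem_roots hpq
  obtain ⟨rfl, rfl⟩ := h.coeffs_eq hi
  exact i.diff_le_one

theorem lie_eq_zero_iff {p q r s : ℕ}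
    (hsum : (p • α₁ + q • α₂) + (r • α₁ + s • α₂) ∈ roots T) {x y : N}
    (hx : x ∈ rootSpace T (p • α₁ + q • α₂)) (hy : y ∈ rootSpace T (r • α₁ + s • α₂))
    (hx0 : x ≠ 0) (hy0 : y ≠ 0) : ⁅x, y⁆ = 0 ↔ diff p q + diff r s = 0 := by
  obtain ⟨i, hi, c, hc, rfl⟩ := h.exists_eq_smul hx hx0
  obtain ⟨j, hj, d, hd, rfl⟩ := h.exists_eq_smul hy hy0
  obtain ⟨k, hk, hk0⟩ := h.exists_of_mem_roots hsum
  obtain ⟨rfl, rfl⟩ := h.coeffs_eq hi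
  obtain ⟨rfl, rfl⟩ := h.coeffs_eq hj
  rw [add_add_add_comm, ← add_smul, ← add_smul] at hk
  obtain ⟨hp, hq⟩ := h.coeffs_eq hk
  rw [← Idx.coeff_eq_zero_iff hp.symm hq.symm, smul_lie, lie_smul,
    lie_serreVec h.serre₁ h.serre₂, smul_eq_zero_iff_right hc, smul_eq_zero_iff_right hd]
  refine ⟨fun e ↦ ?_, fun e ↦ by rw [e, zero_smul]⟩
  by_contra hne
  rw [Idx.add_eq hp.symm hq.symm hne] at e
  exact hk0 ((smul_eq_zero.1 e).resolve_left hne)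

theorem serreVec_eq_zero_iff (i : Idx) :
    serreVec e₁ e₂ i = 0 ↔ i.p • α₁ + i.q • α₂ ∉ roots T := by
  refine ⟨fun h0 hi ↦ ?_, fun hi ↦ ?_⟩
  · obtain ⟨j, hj, hj0⟩ := h.exists_of_mem_roots hi
    have e := h.coeffs_eq hj
    rw [Idx.ext_pq e.1 e.2] at h0
    exact hj0 h0
  · by_contra h0
    exact hi ((Submodule.ne_bot_iff _).2 ⟨_, h.serreVec_mem i, h0⟩)

theorem eq_smul_of_mem₁ {x : N} (hx : x ∈ rootSpace T α₁) : ∃ c : ℂ, x = c • e₁ := by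
  by_cases hx0 : x = 0
  · exact ⟨0, by rw [hx0, zero_smul]⟩
  obtain ⟨i, hi, c, -, rfl⟩ := h.exists_eq_smul hx hx0
  have e := h.coeffs_eq (p := 1) (q := 0) (by simpa using hi)
  obtain rfl : Idx.a 0 = i := Idx.ext_pq e.1 e.2
  exact ⟨c, rfl⟩

theorem eq_smul_of_mem₂ {x : N} (hx : x ∈ rootSpace T α₂) : ∃ c : ℂ, x = c • e₂ := by
  by_cases hx0 : x = 0
  · exact ⟨0, by rw [hx0, zero_smul]⟩
  obtain ⟨i, hi, c, -, rfl⟩ := h.exists_eq_smul hx hx0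
  have e := h.coeffs_eq (p := 0) (q := 1) (by simpa using hi)
  obtain rfl : Idx.b 0 = i := Idx.ext_pq e.1 e.2
  exact ⟨c, rfl⟩

end IsGenerating

end Generators

/-! ### Invariant cohomology of the nilpotent algebra -/

section Extension

open LieModule.Cohomology LieAlgebra

variable {T N M : Type*} [AddCommGroup T] [Module ℂ T] [LieRing N] [LieAlgebra ℂ N]
  [AddCommGroup M] [Module ℂ M] [LieRingModule N M] [LieModule ℂ N M]

/-- The componentwise action of `T` on the extension of `N` by `M` defined by a 2-cocycle. -/
def extAction (c : twoCocycle ℂ N M) (D : T →ₗ[ℂ] Module.End ℂ N) (E : T →ₗ[ℂ] Module.End ℂ M) :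
    T →ₗ[ℂ] Module.End ℂ (ofTwoCocycle c) where
  toFun t :=
    { toFun u := ofProd c (D t u.carrier.1, E t u.carrier.2)
      map_add' _ _ := (ofProd c).symm.injective <| Prod.ext (map_add (D t) _ _) (map_add (E t) _ _)
      map_smul' _ _ := (ofProd c).symm.injective <|
        Prod.ext (map_smul (D t) _ _) (map_smul (E t) _ _) }
  map_add' s t := LinearMap.ext fun _ ↦ (ofProd c).symm.injective <|
    Prod.ext (LinearMap.congr_fun (map_add D s t) _) (LinearMap.congr_fun (map_add E s t) _)
  map_smul' r t := LinearMap.ext fun _ ↦ (ofProd c).symm.injective <|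
    Prod.ext (LinearMap.congr_fun (map_smul D r t) _) (LinearMap.congr_fun (map_smul E r t) _)

/-- The projection of the extension of `N` by `M` defined by a 2-cocycle onto `N`. -/
def extProj (c : twoCocycle ℂ N M) : ofTwoCocycle c →ₗ⁅ℂ⁆ N where
  toFun u := u.carrier.1
  map_add' _ _ := rfl
  map_smul' _ _ := rfl
  map_lie' := rfl

/-- The component in `M` of an element of the extension of `N` by `M` defined by a 2-cocycle. -/
def extSnd (c : twoCocycle ℂ N M) : ofTwoCocycle c →ₗ[ℂ] M where
  toFun u := u.carrier.2
  map_add' _ _ := rfl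
  map_smul' _ _ := rfl

theorem ext_ext {c : twoCocycle ℂ N M} {u v : ofTwoCocycle c} (h1 : extProj c u = extProj c v)
    (h2 : extSnd c u = extSnd c v) : u = v :=
  (ofProd c).symm.injective (Prod.ext h1 h2)

theorem extSnd_lie (c : twoCocycle ℂ N M) (u v : ofTwoCocycle c) :
    extSnd c ⁅u, v⁆ = (c : N →ₗ[ℂ] N →ₗ[ℂ] M) (extProj c u) (extProj c v)
      + ⁅extProj c u, extSnd c v⁆ - ⁅extProj c v, extSnd c u⁆ := rfl

theorem extProj_extAction (c : twoCocycle ℂ N M) (D : T →ₗ[ℂ] Module.End ℂ N)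
    (E : T →ₗ[ℂ] Module.End ℂ M) (t : T) (u : ofTwoCocycle c) :
    extProj c (extAction c D E t u) = D t (extProj c u) := rfl

theorem extSnd_extAction (c : twoCocycle ℂ N M) (D : T →ₗ[ℂ] Module.End ℂ N)
    (E : T →ₗ[ℂ] Module.End ℂ M) (t : T) (u : ofTwoCocycle c) :
    extSnd c (extAction c D E t u) = E t (extSnd c u) := rfl

/-- The action on the extension is by derivations if the cocycle is invariant. -/
theorem extAction_lie {c : twoCocycle ℂ N M} {D : T →ₗ[ℂ] Module.End ℂ N}
    {E : T →ₗ[ℂ] Module.End ℂ M} (hD : ∀ t x y, D t ⁅x, y⁆ = ⁅D t x, y⁆ + ⁅x, D t y⁆)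
    (hE : ∀ t (x : N) (m : M), E t ⁅x, m⁆ = ⁅D t x, m⁆ + ⁅x, E t m⁆)
    (hc : ∀ t x y, E t ((c : N →ₗ[ℂ] N →ₗ[ℂ] M) x y)
      = (c : N →ₗ[ℂ] N →ₗ[ℂ] M) (D t x) y + (c : N →ₗ[ℂ] N →ₗ[ℂ] M) x (D t y))
    (t : T) (u v : ofTwoCocycle c) :
    extAction c D E t ⁅u, v⁆ = ⁅extAction c D E t u, v⁆ + ⁅u, extAction c D E t v⁆ := by
  refine ext_ext (hD t _ _) ?_
  simp only [map_add, map_sub, extSnd_extAction, extProj_extAction, extSnd_lie, hc, hE]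
  abel

end Extension

theorem Subquotient.map_mk_eq_zero_iff {V : Type*} [AddCommGroup V] [Module ℂ V]
    {Z B : Submodule ℂ V} {φ : V →ₗ[ℂ] V} {hZ : ∀ f ∈ Z, φ f ∈ Z} {hB : ∀ f ∈ B, φ f ∈ B}
    {f : Z} : Subquotient.map φ hZ hB (Submodule.Quotient.mk f) = 0 ↔ φ f ∈ B :=
  Submodule.Quotient.mk_eq_zero (B.submoduleOf Z) (x := φ.restrict hZ f)

section Invariant

open LieModule.Cohomology LieAlgebra

variable {N : Type*} [LieRing N] [LieAlgebra ℂ N]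
variable {T : LieSubalgebra ℂ (LieDerivation ℂ N N)}
variable {α₁ α₂ : Module.Dual ℂ T} {e₁ e₂ : N} {t₁ t₂ : T}
variable {M : Type*} [AddCommGroup M] [Module ℂ M]
  [LieRingModule (solvableExt T) M] [LieModule ℂ (solvableExt T) M]

/-- An invariant cocycle with values in a module whose weights are roots or zero is the coboundary
of an equivariant cochain. In the extension `E` of `N` by `M` that it defines, the Serre relations
hold for the lifts of `e₁` and `e₂`, because `3 α₁ + α₂` and `α₁ + 3 α₂` are not weights of `E`.
The element of `E` attached to a root that is not a root of `N` vanishes for the same reason. So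
the elements attached to the roots satisfy in `E` all the linear relations that they satisfy in
`N`, and the projection of `E` onto `N` has an equivariant section. -/
theorem IsGenerating.exists_equivariant_cochain (h : IsGenerating T α₁ α₂ e₁ e₂ t₁ t₂)
    (hW : ∀ χ ∈ weights (torusAction T M), χ = 0 ∨ χ ∈ roots T)
    {f : N →ₗ[ℂ] N →ₗ[ℂ] ResN T M} (hf : f ∈ Z2 N (ResN T M))
    (hinv : ∀ t, cochainAction T M t f = 0) :
    ∃ g : N →ₗ[ℂ] ResN T M, (∀ x y, f x y = ⁅x, g y⁆ - ⁅y, g x⁆ - g ⁅x, y⁆) ∧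
      ∀ t x, g (derAction T t x) = torusAction T (ResN T M) t (g x) := by
  obtain ⟨c₀, hc₀, rfl⟩ := hf
  let c : twoCocycle ℂ N (ResN T M) := ⟨c₀, hc₀⟩
  let ρ := extAction c (derAction T) (torusAction T (ResN T M))
  have hρ : ∀ t u v, ρ t ⁅u, v⁆ = ⁅ρ t u, v⁆ + ⁅u, ρ t v⁆ := by
    refine extAction_lie (derAction_lie T) (torusAction_lie T M) fun t x y ↦ ?_
    have := LinearMap.congr_fun₂ (hinv t) x y
    rw [cochainAction_apply, sub_sub, LinearMap.zero_apply, LinearMap.zero_apply,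
      sub_eq_zero] at this
    exact this
  have hzero : ∀ χ, χ ≠ 0 → χ ∉ roots T → ∀ u ∈ weightSpace ρ χ, u = 0 := by
    intro χ hχ0 hχ u hu
    have hu1 : extProj c u ∈ rootSpace T χ := fun t ↦ congrArg (extProj c) (hu t)
    have hu2 : extSnd c u ∈ weightSpace (torusAction T M) χ := fun t ↦ congrArg (extSnd c) (hu t)
    refine ext_ext ?_ ?_
    · by_contra h0
      exact hχ ((Submodule.ne_bot_iff _).2 ⟨_, hu1, h0⟩)
    · by_contra h0
      exact (hW χ ((Submodule.ne_bot_iff _).2 ⟨_, hu2, h0⟩)).elim hχ0 hχ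
  set x : ofTwoCocycle c := ofProd c (e₁, 0)
  set y : ofTwoCocycle c := ofProd c (e₂, 0)
  have hx : x ∈ weightSpace ρ α₁ := fun t ↦
    ext_ext (h.mem₁ t) ((map_zero (torusAction T (ResN T M) t)).trans (smul_zero (α₁ t)).symm)
  have hy : y ∈ weightSpace ρ α₂ := fun t ↦
    ext_ext (h.mem₂ t) ((map_zero (torusAction T (ResN T M) t)).trans (smul_zero (α₂ t)).symm)
  have hxy : ⁅x, ⁅x, ⁅x, y⁆⁆⁆ = 0 := by
    refine hzero _ ?_ h.h31 _ (serre_mem_weightSpace hρ hx hy)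
    simpa using h.coeffs_ne_zero (p := 3) (q := 1) (by omega)
  have hyx : ⁅y, ⁅y, ⁅y, x⁆⁆⁆ = 0 := by
    refine hzero _ ?_ (add_comm α₁ _ ▸ h.h13) _ (serre_mem_weightSpace hρ hy hx)
    simpa [add_comm] using h.coeffs_ne_zero (p := 1) (q := 3) (by omega)
  obtain ⟨s, hs⟩ := h.exists_linearMap (serreVec x y) fun i hi ↦
    hzero _ (h.coeffs_ne_zero i.pq_ne_zero) ((h.serreVec_eq_zero_iff i).1 hi) _
      (serreVec_mem_weightSpace hρ hx hy i)
  have hπ : ∀ u, extProj c (s u) = u := by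
    refine LinearMap.congr_fun (f := (extProj c : _ →ₗ[ℂ] N) ∘ₗ s) (g := LinearMap.id)
      (LinearMap.ext_on_range h.span_eq_top fun i ↦ ?_)
    change extProj c (s _) = _
    rw [hs, map_serreVec]
    rfl
  have hlie : ∀ u v, s ⁅u, v⁆ = ⁅s u, s v⁆ := by
    intro u v
    have hu : u ∈ Submodule.span ℂ (Set.range (serreVec e₁ e₂)) := by
      rw [h.span_eq_top]; trivial
    have hv : v ∈ Submodule.span ℂ (Set.range (serreVec e₁ e₂)) := by
      rw [h.span_eq_top]; trivial
    induction hu, hv using Submodule.span_induction₂ with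
    | mem_mem u v hu hv =>
      obtain ⟨i, rfl⟩ := hu
      obtain ⟨j, rfl⟩ := hv
      rw [lie_serreVec h.serre₁ h.serre₂, map_smul, hs, hs, hs, lie_serreVec hxy hyx]
    | zero_left => simp
    | zero_right => simp
    | add_left u v w _ _ _ h1 h2 => rw [add_lie, map_add, map_add, add_lie, h1, h2]
    | add_right u v w _ _ _ h1 h2 => rw [lie_add, map_add, map_add, lie_add, h1, h2]
    | smul_left r u v _ _ h1 => rw [smul_lie, map_smul, map_smul, smul_lie, h1]
    | smul_right r u v _ _ h1 => rw [lie_smul, map_smul, map_smul, lie_smul, h1]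
  have hT : ∀ t u, s (derAction T t u) = ρ t (s u) := by
    intro t
    refine LinearMap.congr_fun (f := s ∘ₗ derAction T t) (g := ρ t ∘ₗ s)
      (LinearMap.ext_on_range h.span_eq_top fun i ↦ ?_)
    rw [LinearMap.comp_apply, LinearMap.comp_apply, h.serreVec_mem i t, map_smul, hs,
      serreVec_mem_weightSpace hρ hx hy i t]
  refine ⟨-(extSnd c ∘ₗ s), fun u v ↦ ?_, fun t u ↦ ?_⟩
  · have e := congrArg (extSnd c) (hlie u v)
    rw [extSnd_lie, hπ, hπ] at e
    simp only [LinearMap.neg_apply, LinearMap.comp_apply, lie_neg, e]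
    change (c : N →ₗ[ℂ] N →ₗ[ℂ] ResN T M) u v = _
    abel
  · simp only [LinearMap.neg_apply, LinearMap.comp_apply, hT, map_neg]
    rfl

theorem bilinAction_eq_cochainAction (t : T) :
    bilinAction (derAction T) (torusAction T (ResN T M)) t = cochainAction T M t :=
  LinearMap.ext fun _ ↦ LinearMap.ext fun _ ↦ LinearMap.ext fun _ ↦ rfl

theorem IsGenerating.invariantH2_eq_bot [FiniteDimensional ℂ N] [FiniteDimensional ℂ M]
    (h : IsGenerating T α₁ α₂ e₁ e₂ t₁ t₂) (hT : IsTorus T) [FiniteDimensional ℂ T]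
    (hM : IsDiagonal (torusAction T M)) (hW : weights (torusAction T M) ⊆ roots T) :
    invariantH2 T M = ⊥ := by
  have : FiniteDimensional ℂ (ResN T M) := inferInstanceAs (FiniteDimensional ℂ M)
  have hM' : IsDiagonal (torusAction T (ResN T M)) := hM
  rw [eq_bot_iff]
  intro z hz
  obtain ⟨⟨f, hf⟩, rfl⟩ := Submodule.Quotient.mk_surjective _ z
  have hB : ∀ t, cochainAction T M t f ∈ B2 N (ResN T M) := by
    intro t
    exact Subquotient.map_mk_eq_zero_iff.1 ((Submodule.mem_iInf _).1 hz t)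
  obtain ⟨f₀, h0, hsub⟩ := exists_invariant_sub_mem
    (θ := bilinAction (derAction T) (torusAction T (ResN T M)))
    (fun t ↦ isSemisimple_bilinAction (hT.isSemisimple t) (hM'.isSemisimple t))
    (bilinAction_commute hT.commute hM'.commute)
    (B := B2 N (ResN T M))
    (fun t ↦ by rw [bilinAction_eq_cochainAction]; exact cochainAction_mem_B2 T M t)
    (fun t ↦ by rw [bilinAction_eq_cochainAction]; exact hB t)
  obtain ⟨g, hg, -⟩ := h.exists_equivariant_cochain (fun χ hχ ↦ Or.inr (hW hχ))
    (by simpa using sub_mem hf (B2_le_Z2 _ _ hsub))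
    (fun t ↦ by rw [← bilinAction_eq_cochainAction]; exact h0 t)
  refine (Submodule.mem_bot ℂ).2 ((Submodule.Quotient.mk_eq_zero _).2 ?_)
  change f ∈ B2 N (ResN T M)
  simpa using add_mem hsub (mem_B2_iff.2 ⟨g, hg⟩)

end Invariant

/-! ### Rigidity of the solvable extension -/

section Cartan

variable {L M : Type*} [LieRing L] [LieAlgebra ℂ L] [AddCommGroup M] [Module ℂ M]
  [LieRingModule L M] [LieModule ℂ L M]

theorem Z2_skew {f : L →ₗ[ℂ] L →ₗ[ℂ] M} (hf : f ∈ Z2 L M) (x y : L) : f x y = -f y x := by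
  have h := (mem_Z2_iff.1 hf).1
  have := h (x + y)
  simp only [map_add, LinearMap.add_apply, h, zero_add, add_zero] at this
  exact eq_neg_of_add_eq_zero_right this

/-- Cartan's formula: the Lie derivative of a cocycle `f` along `z` is the coboundary
of `f(z, ·)`. -/
theorem lieDerivative_eq {f : L →ₗ[ℂ] L →ₗ[ℂ] M} (hf : f ∈ Z2 L M) (z x y : L) :
    ⁅z, f x y⁆ - f ⁅z, x⁆ y - f x ⁅z, y⁆ = ⁅x, f z y⁆ - ⁅y, f z x⁆ - f z ⁅x, y⁆ := by
  have h := (mem_Z2_iff.1 hf).2 z x y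
  rw [Z2_skew hf ⁅z, y⁆ x, Z2_skew hf ⁅x, y⁆ z] at h
  rw [← sub_eq_zero, ← h]
  abel

end Cartan

section Rigidity

open LieModule.Cohomology LieAlgebra

variable {N : Type*} [LieRing N] [LieAlgebra ℂ N]
variable {T : LieSubalgebra ℂ (LieDerivation ℂ N N)}

/-- The inclusion of `N` in `N ⋊ T`. -/
abbrev inN (T : LieSubalgebra ℂ (LieDerivation ℂ N N)) : N →ₗ⁅ℂ⁆ solvableExt T :=
  SemiDirectSum.inl T.incl

/-- The inclusion of `T` in `N ⋊ T`. -/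
abbrev inT (T : LieSubalgebra ℂ (LieDerivation ℂ N N)) : T →ₗ⁅ℂ⁆ solvableExt T :=
  SemiDirectSum.inr T.incl

theorem eq_inN_add_inT (r : solvableExt T) : r = inN T r.left + inT T r.right :=
  SemiDirectSum.ext (add_zero r.left).symm (zero_add r.right).symm

theorem inT_lie_inN (t : T) (x : N) : ⁅inT T t, inN T x⁆ = inN T (derAction T t x) := by
  simp [derAction]

theorem inN_lie_inT (x : N) (t : T) : ⁅inN T x, inT T t⁆ = -inN T (derAction T t x) := by
  rw [← lie_skew, inT_lie_inN]

theorem torusAction_self_apply (t : T) (r : solvableExt T) :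
    torusAction T (solvableExt T) t r = ⁅inT T t, r⁆ := rfl

theorem IsTorus.lie_eq_zero (hT : IsTorus T) (s t : T) : ⁅s, t⁆ = 0 := by
  refine derAction_eq_zero (LinearMap.ext fun x ↦ ?_)
  have e : derAction T ⁅s, t⁆ x = derAction T s (derAction T t x)
      - derAction T t (derAction T s x) := rfl
  rw [e, LinearMap.zero_apply, sub_eq_zero]
  exact LinearMap.congr_fun (hT.commute s t).eq x

theorem inT_lie_inT (hT : IsTorus T) (s t : T) : ⁅inT T s, inT T t⁆ = 0 := by
  rw [← LieHom.map_lie, hT.lie_eq_zero, map_zero]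

/-- The components of a weight vector of `N ⋊ T`. -/
theorem left_mem_rootSpace {χ : Module.Dual ℂ T} {r : solvableExt T}
    (hr : r ∈ weightSpace (torusAction T (solvableExt T)) χ) : r.left ∈ rootSpace T χ := by
  intro t
  have := congrArg (SemiDirectSum.projl T.incl) (hr t)
  simpa [torusAction_self_apply, derAction] using this

theorem smul_right_eq_zero (hT : IsTorus T) {χ : Module.Dual ℂ T} {r : solvableExt T}
    (hr : r ∈ weightSpace (torusAction T (solvableExt T)) χ) (t : T) : χ t • r.right = 0 := by
  have e : ⁅t, r.right⁆ = χ t • r.right := congrArg (SemiDirectSum.projr T.incl) (hr t)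
  rw [← e, hT.lie_eq_zero]

theorem isDiagonal_solvableExt (hT : IsTorus T) :
    IsDiagonal (torusAction T (solvableExt T)) := by
  rw [IsDiagonal, eq_top_iff]
  intro r _
  rw [eq_inN_add_inT r]
  refine add_mem ?_ ?_
  · induction r.left using IsDiagonal.induction hT with
    | mem χ v hv =>
      refine Submodule.mem_iSup_of_mem χ fun t ↦ ?_
      rw [torusAction_self_apply, inT_lie_inN, hv t, map_smul]
    | zero => rw [map_zero]; exact zero_mem _
    | add v w hv hw => rw [map_add]; exact add_mem hv hw
  · refine Submodule.mem_iSup_of_mem 0 fun t ↦ ?_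
    rw [torusAction_self_apply, inT_lie_inT hT, LinearMap.zero_apply, zero_smul]

theorem weights_solvableExt (hT : IsTorus T) (χ : Module.Dual ℂ T)
    (hχ : χ ∈ weights (torusAction T (solvableExt T))) : χ = 0 ∨ χ ∈ roots T := by
  obtain ⟨r, hr, hr0⟩ := (Submodule.ne_bot_iff _).1 hχ
  by_cases hl : r.left = 0
  · left
    ext t
    refine (smul_eq_zero.1 (smul_right_eq_zero hT hr t)).resolve_right fun h0 ↦ hr0 ?_
    rw [eq_inN_add_inT r, hl, h0, map_zero, map_zero, add_zero]
  · exact Or.inr ((Submodule.ne_bot_iff _).2 ⟨_, left_mem_rootSpace hr, hl⟩)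

section Contraction

variable {f : solvableExt T →ₗ[ℂ] solvableExt T →ₗ[ℂ] solvableExt T}
  (hinv : ∀ t x y, ⁅inT T t, f x y⁆ = f ⁅inT T t, x⁆ y + f x ⁅inT T t, y⁆)
include hinv

/-- The contraction of an invariant cocycle with an element of `T` is a derivation. -/
theorem contraction_lie (hf : f ∈ Z2 (solvableExt T) (solvableExt T)) (t : T)
    (x y : solvableExt T) : f (inT T t) ⁅x, y⁆ = ⁅x, f (inT T t) y⁆ - ⁅y, f (inT T t) x⁆ := by
  have e := lieDerivative_eq hf (inT T t) x y
  rw [hinv, add_sub_cancel_left, sub_self] at e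
  exact (sub_eq_zero.1 e.symm).symm

/-- The contraction of an invariant cocycle with an element of `T` preserves weights. -/
theorem contraction_mem (hT : IsTorus T) {χ : Module.Dual ℂ T} {x : N} (hx : x ∈ rootSpace T χ)
    (t : T) : f (inT T t) (inN T x) ∈ weightSpace (torusAction T (solvableExt T)) χ := by
  intro s
  rw [torusAction_self_apply, hinv, inT_lie_inT hT, map_zero, LinearMap.zero_apply, zero_add,
    inT_lie_inN, hx s, map_smul, map_smul]

end Contraction

namespace IsGenerating

variable {α₁ α₂ : Module.Dual ℂ T} {e₁ e₂ : N} {t₁ t₂ : T}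
variable (h : IsGenerating T α₁ α₂ e₁ e₂ t₁ t₂) (hT : IsTorus T)
variable {f : solvableExt T →ₗ[ℂ] solvableExt T →ₗ[ℂ] solvableExt T}
variable (hf : f ∈ Z2 (solvableExt T) (solvableExt T))
  (hinv : ∀ t x y, ⁅inT T t, f x y⁆ = f ⁅inT T t, x⁆ y + f x ⁅inT T t, y⁆)

include h hT hf hinv in
/-- An invariant cocycle that vanishes on `T × {e₁, e₂}` vanishes on `T × (N ⋊ T)`. -/
theorem contraction_eq_zero (hz₁ : ∀ t, f (inT T t) (inN T e₁) = 0)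
    (hz₂ : ∀ t, f (inT T t) (inN T e₂) = 0) (t : T) : f (inT T t) = 0 := by
  have hN : ∀ x, f (inT T t) (inN T x) = 0 := by
    have : (f (inT T t) ∘ₗ (inN T : N →ₗ[ℂ] solvableExt T) :
        N →ₗ[ℂ] ResN T (solvableExt T)) = 0 := by
      refine derivation_eq_zero (fun u v ↦ ?_) h.gen ?_
      · change f (inT T t) (inN T ⁅u, v⁆) = ⁅inN T u, f (inT T t) (inN T v)⁆
          - ⁅inN T v, f (inT T t) (inN T u)⁆
        rw [LieHom.map_lie, contraction_lie hinv hf]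
      · rintro _ (rfl | rfl)
        · exact hz₁ t
        · exact hz₂ t
    exact LinearMap.congr_fun this
  have hTT : ∀ s, f (inT T t) (inT T s) = 0 := by
    intro s
    set m := f (inT T t) (inT T s) with hm
    have hm0 : m ∈ weightSpace (torusAction T (solvableExt T)) 0 := by
      intro s'
      rw [torusAction_self_apply, hm, hinv, inT_lie_inT hT, inT_lie_inT hT]
      simp only [map_zero, LinearMap.zero_apply, add_zero, zero_smul]
    have hl : m.left = 0 := by
      by_contra h0
      exact h.zero_notMem_roots ((Submodule.ne_bot_iff _).2 ⟨_, left_mem_rootSpace hm0, h0⟩)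
    have hm' : m = inT T m.right := (eq_inN_add_inT m).trans (by rw [hl, map_zero, zero_add])
    have key : ∀ e : N, derAction T m.right e = 0 := by
      intro e
      have h1 := contraction_lie hinv hf t (inT T s) (inN T e)
      rw [inT_lie_inN, hN, hN, lie_zero, zero_sub, ← hm, hm', inN_lie_inT, neg_neg] at h1
      exact (congrArg (SemiDirectSum.projl T.incl) h1).symm
    rw [hm', derAction_eq_zero (LinearMap.ext key), map_zero]
  ext1 r
  rw [eq_inN_add_inT r, map_add, hN, hTT, add_zero, LinearMap.zero_apply]

include h hT hf hinv in
/-- An invariant cocycle that vanishes on `T × (N ⋊ T)` is determined by an invariant cocycle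
of `N`, and an equivariant cochain of `N` with this coboundary is extended by zero to `T`. -/
theorem mem_B2_of_contraction_eq_zero (hz : ∀ t, f (inT T t) = 0) :
    f ∈ B2 (solvableExt T) (solvableExt T) := by
  let fN : N →ₗ[ℂ] N →ₗ[ℂ] ResN T (solvableExt T) :=
    f.compl₁₂ (inN T : N →ₗ[ℂ] solvableExt T) (inN T : N →ₗ[ℂ] solvableExt T)
  have hZ : fN ∈ Z2 N (ResN T (solvableExt T)) := by
    obtain ⟨h1, h2⟩ := mem_Z2_iff.1 hf
    refine mem_Z2_iff.2 ⟨fun x ↦ h1 _, fun x y z ↦ ?_⟩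
    have := h2 (inN T x) (inN T y) (inN T z)
    rw [← LieHom.map_lie, ← LieHom.map_lie, ← LieHom.map_lie] at this
    exact this
  have hI : ∀ t, cochainAction T (solvableExt T) t fN = 0 := by
    intro t
    refine LinearMap.ext fun x ↦ LinearMap.ext fun y ↦ ?_
    have := hinv t (inN T x) (inN T y)
    rw [inT_lie_inN, inT_lie_inN, ← sub_eq_zero, ← sub_sub] at this
    exact this
  obtain ⟨g, hg, hgT⟩ := h.exists_equivariant_cochain (weights_solvableExt hT) hZ hI
  let g' : N →ₗ[ℂ] solvableExt T := g
  have hg' : ∀ x y, f (inN T x) (inN T y) = ⁅inN T x, g' y⁆ - ⁅inN T y, g' x⁆ - g' ⁅x, y⁆ := hg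
  have hgT' : ∀ t x, g' (derAction T t x) = ⁅inT T t, g' x⁆ := hgT
  refine mem_B2_iff.2 ⟨g' ∘ₗ SemiDirectSum.projl T.incl, fun r r' ↦ ?_⟩
  have hl : ∀ r r' : solvableExt T, ⁅r, r'⁆.left
      = ⁅r.left, r'.left⁆ + derAction T r.right r'.left - derAction T r'.right r.left :=
    fun _ _ ↦ rfl
  have hz' : ∀ r t, f r (inT T t) = 0 := by
    intro r t
    rw [Z2_skew hf, hz, LinearMap.zero_apply, neg_zero]
  have hL : f r r' = f (inN T r.left) (inN T r'.left) := by
    nth_rw 1 [eq_inN_add_inT r, eq_inN_add_inT r']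
    simp [hz, hz', -SemiDirectSum.add_eq_mk, -SemiDirectSum.inl_eq_mk, -SemiDirectSum.inr_eq_mk]
  have e1 : ∀ m : solvableExt T, ⁅r, m⁆ = ⁅inN T r.left, m⁆ + ⁅inT T r.right, m⁆ := fun m ↦ by
    rw [← add_lie, ← eq_inN_add_inT]
  have e2 : ∀ m : solvableExt T, ⁅r', m⁆ = ⁅inN T r'.left, m⁆ + ⁅inT T r'.right, m⁆ := fun m ↦ by
    rw [← add_lie, ← eq_inN_add_inT]
  rw [hL, hg', LinearMap.comp_apply, LinearMap.comp_apply, LinearMap.comp_apply,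
    SemiDirectSum.projl_mk, SemiDirectSum.projl_mk, SemiDirectSum.projl_mk, hl, map_sub, map_add,
    hgT', hgT', e1, e2]
  abel

include h hT hinv in
/-- The values of an invariant cocycle on `T × {e₁, e₂}`. -/
theorem exists_contraction_eq : ∃ l₁ l₂ : Module.Dual ℂ T,
    (∀ t, f (inT T t) (inN T e₁) = l₁ t • inN T e₁) ∧
    (∀ t, f (inT T t) (inN T e₂) = l₂ t • inN T e₂) := by
  have key : ∀ (χ : Module.Dual ℂ T) (e : N), χ ≠ 0 → e ≠ 0 → e ∈ rootSpace T χ →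
      (∀ x ∈ rootSpace T χ, ∃ c : ℂ, x = c • e) → ∃ l : Module.Dual ℂ T,
      ∀ t, f (inT T t) (inN T e) = l t • inN T e := by
    intro χ e hχ he hmem hdim
    obtain ⟨ξ, hξ⟩ : ∃ ξ : Module.Dual ℂ N, ξ e ≠ 0 := by
      by_contra! h0
      exact he ((Module.forall_dual_apply_eq_zero_iff ℂ e).1 h0)
    refine ⟨(ξ e)⁻¹ • (ξ ∘ₗ SemiDirectSum.projl T.incl ∘ₗ f.flip (inN T e) ∘ₗ
      (inT T : T →ₗ[ℂ] solvableExt T)), fun t ↦ ?_⟩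
    have hw := contraction_mem hinv hT hmem t
    obtain ⟨c, hc⟩ := hdim _ (left_mem_rootSpace hw)
    have hr : (f (inT T t) (inN T e)).right = 0 := by
      obtain ⟨s, hs⟩ : ∃ s, χ s ≠ 0 := by
        by_contra! h0
        exact hχ (LinearMap.ext h0)
      exact (smul_eq_zero.1 (smul_right_eq_zero hT hw s)).resolve_left hs
    have hl : ((ξ e)⁻¹ • (ξ ∘ₗ SemiDirectSum.projl T.incl ∘ₗ f.flip (inN T e) ∘ₗ
        (inT T : T →ₗ[ℂ] solvableExt T))) t = c := by
      change (ξ e)⁻¹ * ξ (f (inT T t) (inN T e)).left = c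
      rw [hc, map_smul, smul_eq_mul]
      field_simp
    rw [hl, eq_inN_add_inT (f (inT T t) (inN T e)), hr, hc, map_zero, add_zero, map_smul]
  obtain ⟨l₁, hl₁⟩ := key α₁ e₁ (fun h0 ↦ by simpa [h0] using h.h₁₁) h.ne₁ h.mem₁
    fun x hx ↦ h.eq_smul_of_mem₁ hx
  obtain ⟨l₂, hl₂⟩ := key α₂ e₂ (fun h0 ↦ by simpa [h0] using h.h₂₂) h.ne₂ h.mem₂
    fun x hx ↦ h.eq_smul_of_mem₂ hx
  exact ⟨l₁, l₂, hl₁, hl₂⟩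

include h hT hf hinv in
/-- An invariant cocycle of `N ⋊ T` is a coboundary: `f(t, ·)` is a derivation of weight zero, so
on `N` it agrees with an element `φ t` of `T`, and subtracting the coboundary of `φ` leaves a
cocycle that vanishes on `T × (N ⋊ T)`. -/
theorem mem_B2_of_invariant : f ∈ B2 (solvableExt T) (solvableExt T) := by
  obtain ⟨l₁, l₂, hl₁, hl₂⟩ := h.exists_contraction_eq hT hinv
  let φ : T →ₗ[ℂ] T := l₁.smulRight t₁ + l₂.smulRight t₂
  have hφ₁ : ∀ t, α₁ (φ t) = l₁ t := fun t ↦ by simp [φ, h.h₁₁, h.h₁₂]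
  have hφ₂ : ∀ t, α₂ (φ t) = l₂ t := fun t ↦ by simp [φ, h.h₂₁, h.h₂₂]
  let k : solvableExt T →ₗ[ℂ] solvableExt T :=
    (inT T : T →ₗ[ℂ] solvableExt T) ∘ₗ φ ∘ₗ (SemiDirectSum.projr T.incl : solvableExt T →ₗ[ℂ] T)
  have hk : ∀ r, k r = inT T (φ r.right) := fun _ ↦ rfl
  have hkN : ∀ x, k (inN T x) = 0 := fun x ↦ by
    rw [hk, show (inN T x).right = 0 from rfl, map_zero, map_zero]
  have hklie : ∀ r r' : solvableExt T, k ⁅r, r'⁆ = 0 := by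
    intro r r'
    have h0 : ⁅r, r'⁆.right = 0 := hT.lie_eq_zero r.right r'.right
    rw [hk, h0, map_zero, map_zero]
  have hTk : ∀ t r, ⁅inT T t, k r⁆ = 0 := fun t r ↦ inT_lie_inT hT _ _
  let dk : solvableExt T →ₗ[ℂ] solvableExt T →ₗ[ℂ] solvableExt T :=
    (d₁₂ ℂ (solvableExt T) (solvableExt T) k : twoCochain ℂ (solvableExt T) (solvableExt T)).1
  have hdk : ∀ r r', dk r r' = ⁅r, k r'⁆ - ⁅r', k r⁆ := by
    intro r r'
    have : dk r r' = ⁅r, k r'⁆ - ⁅r', k r⁆ - k ⁅r, r'⁆ := rfl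
    rw [this, hklie, sub_zero]
  have hdkB : dk ∈ B2 (solvableExt T) (solvableExt T) := mem_B2_iff.2 ⟨k, fun _ _ ↦ rfl⟩
  have hfZ : f - dk ∈ Z2 (solvableExt T) (solvableExt T) := sub_mem hf (B2_le_Z2 _ _ hdkB)
  have hfI : ∀ t x y, ⁅inT T t, (f - dk) x y⁆
      = (f - dk) ⁅inT T t, x⁆ y + (f - dk) x ⁅inT T t, y⁆ := by
    intro t x y
    have h1 : ⁅inT T t, ⁅x, k y⁆⁆ = ⁅⁅inT T t, x⁆, k y⁆ := by
      rw [leibniz_lie, hTk, lie_zero, add_zero]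
    have h2 : ⁅inT T t, ⁅y, k x⁆⁆ = ⁅⁅inT T t, y⁆, k x⁆ := by
      rw [leibniz_lie, hTk, lie_zero, add_zero]
    simp only [LinearMap.sub_apply, lie_sub, hinv t x y, hdk, h1, h2, hklie, lie_zero]
    abel
  have hval : ∀ (χ : Module.Dual ℂ T) (e : N) (t : T), e ∈ rootSpace T χ →
      dk (inT T t) (inN T e) = χ (φ t) • inN T e := by
    intro χ e t he
    rw [hdk, hkN, lie_zero, zero_sub, hk, show (inT T t).right = t from rfl, inN_lie_inT, neg_neg,
      he, map_smul]
  have hz := h.contraction_eq_zero hT hfZ hfI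
    (fun t ↦ by rw [LinearMap.sub_apply, LinearMap.sub_apply, hl₁, hval _ _ _ h.mem₁, hφ₁,
      sub_self])
    (fun t ↦ by rw [LinearMap.sub_apply, LinearMap.sub_apply, hl₂, hval _ _ _ h.mem₂, hφ₂,
      sub_self])
  simpa using add_mem (h.mem_B2_of_contraction_eq_zero hT hfZ hfI hz) hdkB

include h hT in
/-- By Cartan's formula `T` acts trivially on the cohomology of `N ⋊ T`, so that every class has an
invariant representative. -/
theorem isCohomologicallyRigid [FiniteDimensional ℂ N] [FiniteDimensional ℂ T] :
    IsCohomologicallyRigid (solvableExt T) := by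
  have : FiniteDimensional ℂ (solvableExt T) :=
    (SemiDirectSum.toProdl T.incl).symm.finiteDimensional
  have hD := isDiagonal_solvableExt hT
  let θ := bilinAction (torusAction T (solvableExt T)) (torusAction T (solvableExt T))
  have hθ : ∀ t, ∀ f ∈ Z2 (solvableExt T) (solvableExt T),
      θ t f ∈ B2 (solvableExt T) (solvableExt T) := fun t f hf ↦
    mem_B2_iff.2 ⟨f (inT T t), lieDerivative_eq hf (inT T t)⟩
  refine subsingleton_of_forall_eq 0 fun z ↦ ?_
  obtain ⟨⟨f, hf⟩, rfl⟩ := Submodule.Quotient.mk_surjective _ z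
  refine (Submodule.Quotient.mk_eq_zero _).2 ?_
  change f ∈ B2 (solvableExt T) (solvableExt T)
  obtain ⟨f₀, h0, hsub⟩ := exists_invariant_sub_mem (θ := θ)
    (fun t ↦ isSemisimple_bilinAction (hD.isSemisimple t) (hD.isSemisimple t))
    (bilinAction_commute hD.commute hD.commute)
    (fun t b hb ↦ hθ t b (B2_le_Z2 _ _ hb)) (fun t ↦ hθ t f hf)
  have hf₀ : f₀ ∈ Z2 (solvableExt T) (solvableExt T) := by
    simpa using sub_mem hf (B2_le_Z2 _ _ hsub)
  have hinv : ∀ t x y, ⁅inT T t, f₀ x y⁆ = f₀ ⁅inT T t, x⁆ y + f₀ x ⁅inT T t, y⁆ := by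
    intro t x y
    have := LinearMap.congr_fun₂ (h0 t) x y
    rw [bilinAction_apply, sub_sub, LinearMap.zero_apply, LinearMap.zero_apply, sub_eq_zero] at this
    exact this
  simpa using add_mem hsub (h.mem_B2_of_invariant hT hf₀ hinv)

end IsGenerating

end Rigidity

end MaxRank

end

theorem theorem4p7
    (N : Type*) [LieRing N] [LieAlgebra ℂ N] [FiniteDimensional ℂ N] [LieRing.IsNilpotent N]
    (T : LieSubalgebra ℂ (LieDerivation ℂ N N)) (hT : MaxRank.IsMaximalTorus T)
    (hrank : Module.finrank ℂ T = 2)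
    (hmax : Module.finrank ℂ (N ⧸ MaxRank.derivedIdeal N) = 2)
    (α₁ α₂ : Module.Dual ℂ T) (hne : α₁ ≠ α₂)
    (h₁ : MaxRank.IsPrimitive T α₁) (h₂ : MaxRank.IsPrimitive T α₂)
    (hgen : LieSubalgebra.lieSpan ℂ N
      ((MaxRank.rootSpace T α₁ : Set N) ∪ (MaxRank.rootSpace T α₂ : Set N)) = ⊤)
    (h31 : 3 • α₁ + α₂ ∉ MaxRank.roots T) (h13 : α₁ + 3 • α₂ ∉ MaxRank.roots T) :
    -- every weight is `p α₁ + q α₂`, for a unique pair of natural numbers, and `|p - q| ≤ 1`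
    (∀ μ ∈ MaxRank.roots T, ∃! c : ℕ × ℕ, μ = c.1 • α₁ + c.2 • α₂) ∧
    (∀ p q : ℕ, p • α₁ + q • α₂ ∈ MaxRank.roots T → MaxRank.diff p q ≤ 1) ∧
    -- when a bracket of weight vectors vanishes
    (∀ p q r s : ℕ, p • α₁ + q • α₂ ∈ MaxRank.roots T → r • α₁ + s • α₂ ∈ MaxRank.roots T →
      (p • α₁ + q • α₂) + (r • α₁ + s • α₂) ∈ MaxRank.roots T →
      ∀ x ∈ MaxRank.rootSpace T (p • α₁ + q • α₂), ∀ y ∈ MaxRank.rootSpace T (r • α₁ + s • α₂),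
        x ≠ 0 → y ≠ 0 → (⁅x, y⁆ = 0 ↔ MaxRank.diff p q + MaxRank.diff r s = 0)) ∧
    -- `H²(N, M)^T = 0` for every diagonal module `M` with weights in `W`
    (∀ (M : Type*) [AddCommGroup M] [Module ℂ M] [FiniteDimensional ℂ M]
      [LieRingModule (MaxRank.solvableExt T) M] [LieModule ℂ (MaxRank.solvableExt T) M],
      MaxRank.IsDiagonal (MaxRank.torusAction T M) →
      MaxRank.weights (MaxRank.torusAction T M) ⊆ MaxRank.roots T →
      MaxRank.invariantH2 T M = ⊥) ∧
    -- rigidity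
    MaxRank.IsCohomologicallyRigid (MaxRank.solvableExt T) := by
  have : FiniteDimensional ℂ T := FiniteDimensional.of_finrank_pos (by omega)
  obtain ⟨e₁, e₂, t₁, t₂, h⟩ := MaxRank.exists_isGenerating hrank hmax h₁ h₂ hgen h31 h13
  exact ⟨fun μ hμ ↦ h.existsUnique_coeffs hμ, fun p q hpq ↦ h.diff_le_one hpq,
    fun p q r s _ _ hsum x hx y hy hx0 hy0 ↦ h.lie_eq_zero_iff hsum hx hy hx0 hy0,
    fun M _ _ _ _ _ hM hW ↦ h.invariantH2_eq_bot hT.prop hM hW,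
    h.isCohomologicallyRigid hT.prop⟩
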